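/- Let $k$ be a finite field with $q$ elements, $A=k[t]$, $F=k(t)$, where $t$ is the standard coordinate on $\mathbf{P}^1=\mathbf{P}^1_k$, so that $\operatorname{Spec}A=\mathbf{P}^1\setminus\{\infty\}$. Let $X$ be a smooth projective geometrically connected (integral) curve over $k$ with function field $K$, let $\pi\colon X\to\mathbf{P}^1$ be a surjective morphism over $k$, and let $Y=\pi^{-1}(\operatorname{Spec}A)\subset X$. For $z\in X\setminus Y$ let $K_z$ be the completion of $K$ at $z$. For an $A$-algebra $R$ let $C_0(R)$ be the additive group of $R$ with the $A$-module structure that is $k$-linear and in which $t$ acts by $c\mapsto tc+c^q$; for an open $V\subset Y$ put $C_0(V)=C_0(\Gamma(V,\mathcal{O}_X))$. Let $\exp x=x+e_1x^q+e_2x^{q^2}+\cdots\in F[[x]]$ be the unique power series of this form with $\exp(tx)=t\exp x+(\exp x)^q$. Let $C$ be the sheaf of $A$-modules on $X$ (for the Zariski topology) given by $$C(U)=\Big\{(c,(\gamma_z)_z)\in C_0(U\cap Y)\times\prod_{z\in U\setminus Y}K_z \;\Big|\; \exp\gamma_z=c \text{ in } C_0(K_z) \text{ for all } z\Big\}.$$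 Then for every $z\in X\setminus Y$ the series $\exp$ converges on all of $K_z$, the map $$\delta\colon C_0(Y)\times\prod_{z\in X\setminus Y}K_z\to\prod_{z\in X\setminus Y}C_0(K_z),\qquad (c,(\gamma_z)_z)\mapsto(c-\exp\gamma_z)_z$$ is $A$-linear, and there is an exact sequence of $A$-modules $$0\to C(X)\to C_0(Y)\times\prod_{z\in X\setminus Y}K_z\xrightarrow{\ \delta\ }\prod_{z\in X\setminus Y}C_0(K_z)\to H^1(X,C)\to 0$$ in which the first map is the inclusion. -/

import Mathlib

open CategoryTheory AlgebraicGeometry TopologicalSpace Opposite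

universe u

noncomputable section

attribute [local instance] MvPolynomial.gradedAlgebra

namespace Carlitz

/-! ### Projective space over a field -/

/-- Projective `n`-space `Proj k[x₀, …, xₙ]` over `k`. -/
def ProjSpace (n : ℕ) (k : Type u) [Field k] : Scheme.{u} :=
  Proj (MvPolynomial.homogeneousSubmodule (Fin (n + 1)) k)

/-- The structure morphism of projective `n`-space. -/
def ProjSpace.toSpec (n : ℕ) (k : Type u) [Field k] : ProjSpace n k ⟶ Spec (.of k) :=
  Proj.toSpecZero (MvPolynomial.homogeneousSubmodule (Fin (n + 1)) k) ≫
    Spec.map (CommRingCat.ofHom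
      (algebraMap k (MvPolynomial.homogeneousSubmodule (Fin (n + 1)) k 0)))

/-- A `k`-scheme is projective if it is a closed subscheme of some projective space over `k`. -/
def IsProjective {k : Type u} [Field k] {X : Scheme.{u}} (p : X ⟶ Spec (.of k)) : Prop :=
  ∃ (n : ℕ) (i : X ⟶ ProjSpace n k), IsClosedImmersion i ∧ i ≫ ProjSpace.toSpec n k = p

section P1

variable (k : Type u) [Field k]

/-- The affine line `𝐏¹ - ∞ = D₊(x₀)`; the point at infinity is `x₀ = 0`. -/
def affineLine : (ProjSpace 1 k).Opens :=
  Proj.basicOpen (MvPolynomial.homogeneousSubmodule (Fin 2) k) (MvPolynomial.X 0)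

lemma X_mem (i : Fin 2) : (MvPolynomial.X i : MvPolynomial (Fin 2) k) ∈
    MvPolynomial.homogeneousSubmodule (Fin 2) k 1 :=
  MvPolynomial.isHomogeneous_X k i

/-- The coordinate `t = x₁ / x₀`. -/
def coordAway : HomogeneousLocalization.Away (MvPolynomial.homogeneousSubmodule (Fin 2) k)
    (MvPolynomial.X (0 : Fin 2)) :=
  HomogeneousLocalization.Away.mk (MvPolynomial.homogeneousSubmodule (Fin 2) k)
    (d := 1) (X_mem k 0) 1 (MvPolynomial.X 1)
    (by simpa only [one_smul] using X_mem k 1)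

/-- The map `k[t] → (k[x₀, x₁][1/x₀])₀`. -/
def polyToAway : Polynomial k →+*
    HomogeneousLocalization.Away (MvPolynomial.homogeneousSubmodule (Fin 2) k)
      (MvPolynomial.X (0 : Fin 2)) :=
  Polynomial.eval₂RingHom
    ((HomogeneousLocalization.fromZeroRingHom
      (MvPolynomial.homogeneousSubmodule (Fin 2) k) _).comp
      (algebraMap k (MvPolynomial.homogeneousSubmodule (Fin 2) k 0)))
    (coordAway k)

/-- The map `A = k[t] → Γ(𝐏¹ - ∞, 𝒪)` sending the variable to the coordinate `t`. -/
def polyToSections : Polynomial k →+* Γ(ProjSpace 1 k, affineLine k) :=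
  (Proj.awayToSection (MvPolynomial.homogeneousSubmodule (Fin 2) k)
    (MvPolynomial.X 0)).hom.comp (polyToAway k)

lemma polyToAway_injective : Function.Injective (polyToAway k) := by
  have hu : IsUnit (MvPolynomial.aeval (R := k) (fun i : Fin 2 => if i = 0 then 1 else
      (Polynomial.X : Polynomial k)) (MvPolynomial.X (0 : Fin 2))) := by simp
  let r : Localization.Away (MvPolynomial.X (0 : Fin 2) : MvPolynomial (Fin 2) k) →+*
      Polynomial k := IsLocalization.Away.lift _ (g := (MvPolynomial.aeval (R := k)
        (fun i : Fin 2 => if i = 0 then 1 else (Polynomial.X : Polynomial k))).toRingHom) hu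
  have key : (r.comp (algebraMap _ _)).comp (polyToAway k) = RingHom.id _ := by
    refine Polynomial.ringHom_ext (fun a => ?_) ?_
    · simp only [polyToAway, RingHom.comp_apply, Polynomial.coe_eval₂RingHom,
        Polynomial.eval₂_C, RingHom.id_apply]
      change r (HomogeneousLocalization.val (HomogeneousLocalization.fromZeroRingHom
        (MvPolynomial.homogeneousSubmodule (Fin 2) k) _ _)) = _
      change r (Localization.mk (MvPolynomial.C a) 1) = _
      rw [Localization.mk_one_eq_algebraMap]
      simp [r, IsLocalization.Away.lift_eq]
    · simp only [polyToAway, RingHom.comp_apply, Polynomial.coe_eval₂RingHom,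
        Polynomial.eval₂_X, RingHom.id_apply]
      change r (HomogeneousLocalization.val (coordAway k)) = _
      rw [coordAway, HomogeneousLocalization.Away.val_mk, Localization.mk_eq_mk']
      refine (IsLocalization.lift_mk'_spec _ _ _ _).mpr ?_
      simp
  intro a b h
  have := congrArg (r.comp (algebraMap _ _)) h
  rw [← RingHom.comp_apply, ← RingHom.comp_apply, key] at this
  simpa using this

lemma polyToSections_injective : Function.Injective (polyToSections k) := by
  intro a b h
  apply polyToAway_injective k
  have e := Proj.basicOpenIsoAway (MvPolynomial.homogeneousSubmodule (Fin 2) k)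
    (f := MvPolynomial.X 0) (X_mem k 0) one_pos
  have hi : IsIso (Proj.awayToSection (MvPolynomial.homogeneousSubmodule (Fin 2) k)
    (MvPolynomial.X 0)) := by
    rw [← Proj.basicOpenIsoAway_hom (MvPolynomial.homogeneousSubmodule (Fin 2) k)
      (f := MvPolynomial.X 0) (X_mem k 0) one_pos]
    infer_instance
  exact ((ConcreteCategory.isIso_iff_bijective _).mp hi).1 h

lemma basicOpen_polyToSections_ne_bot {a : Polynomial k} (ha : a ≠ 0) :
    (ProjSpace 1 k).basicOpen (polyToSections k a) ≠ ⊥ := by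
  have hc : IsCompact ((affineLine k : (ProjSpace 1 k).Opens) : Set (ProjSpace 1 k)) :=
    (Proj.isAffineOpen_basicOpen (MvPolynomial.homogeneousSubmodule (Fin 2) k)
      (f := MvPolynomial.X 0) (X_mem k 0) one_pos).isCompact
  rw [Ne, ← Scheme.isNilpotent_iff_basicOpen_eq_bot_of_isCompact hc]
  rintro ⟨n, hn⟩
  rw [← map_pow, map_eq_zero_iff _ (polyToSections_injective k)] at hn
  exact ha (pow_eq_zero_iff (n := n) (by rintro rfl; simp at hn) |>.mp hn)

end P1

/-! ### The Carlitz module -/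

section CarlitzModule

variable (k : Type u) [Field k] [Fintype k] (R : Type u) [CommRing R] [Algebra (Polynomial k) R]

/-- The `q`-power map of a `k[t]`-algebra, where `q = #k`. -/
def frob : R →+* R :=
  letI : Algebra k R := ((algebraMap (Polynomial k) R).comp Polynomial.C).toAlgebra
  (FiniteField.frobeniusAlgHom k R).toRingHom

lemma frob_apply (c : R) : frob k R c = c ^ Fintype.card k := rfl

lemma frob_algebraMap_C (a : k) :
    frob k R (algebraMap (Polynomial k) R (Polynomial.C a)) =
      algebraMap (Polynomial k) R (Polynomial.C a) := by
  rw [frob_apply, ← map_pow, ← map_pow, FiniteField.pow_card]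

/-- The additive endomorphism `c ↦ t c + c ^ q`. -/
def tAction : AddMonoid.End R :=
  AddMonoidHom.mulLeft (algebraMap (Polynomial k) R Polynomial.X) + (frob k R).toAddMonoidHom

/-- The ring homomorphism `φ : k[t] → End R`, `k`-linear with `φ t = (c ↦ t c + c ^ q)`. -/
def action : Polynomial k →+* AddMonoid.End R :=
  Polynomial.eval₂RingHom'
    (((Module.toAddMonoidEnd R R).comp (algebraMap (Polynomial k) R)).comp Polynomial.C)
    (tAction k R) (by
      intro a
      refine AddMonoidHom.ext fun c => ?_
      change algebraMap (Polynomial k) R (Polynomial.C a) *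
          (algebraMap (Polynomial k) R Polynomial.X * c + frob k R c) =
        algebraMap (Polynomial k) R Polynomial.X *
            (algebraMap (Polynomial k) R (Polynomial.C a) * c) +
          frob k R (algebraMap (Polynomial k) R (Polynomial.C a) * c)
      rw [map_mul, frob_algebraMap_C]
      ring)

/-- The Carlitz module `C₀(R)` of a `k[t]`-algebra `R`: the additive group of `R`, with `k[t]`
acting through `action`. -/
@[nolint unusedArguments]
def C0 (k : Type u) [Field k] [Fintype k] (R : Type u) [CommRing R] [Algebra (Polynomial k) R] :
    Type u := R

instance : AddCommGroup (C0 k R) := inferInstanceAs (AddCommGroup R)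

instance : Module (Polynomial k) (C0 k R) :=
  letI : Module (AddMonoid.End R) (C0 k R) := inferInstanceAs (Module (AddMonoid.End R) R)
  Module.compHom (C0 k R) (action k R)

/-- The identity map from `R` to `C₀(R)`. -/
def toC0 : R ≃+ C0 k R := AddEquiv.refl R

lemma C_smul_toC0 (a : k) (c : R) : Polynomial.C a • toC0 k R c =
    toC0 k R (algebraMap (Polynomial k) R (Polynomial.C a) * c) := by
  change action k R (Polynomial.C a) c = _
  simp only [action, Polynomial.eval₂RingHom', RingHom.coe_mk, MonoidHom.coe_mk, OneHom.coe_mk,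
    Polynomial.eval₂_C]
  rfl

lemma X_smul_toC0 (c : R) : (Polynomial.X : Polynomial k) • toC0 k R c =
    toC0 k R (algebraMap (Polynomial k) R Polynomial.X * c + c ^ Fintype.card k) := by
  change action k R Polynomial.X c = _
  simp only [action, Polynomial.eval₂RingHom', RingHom.coe_mk, MonoidHom.coe_mk, OneHom.coe_mk,
    Polynomial.eval₂_X]
  rfl

variable {R} {S : Type u} [CommRing S] [Algebra (Polynomial k) S]

/-- Functoriality of `C₀`. -/
def C0.map (f : R →ₐ[Polynomial k] S) : C0 k R →ₗ[Polynomial k] C0 k S where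
  toFun c := toC0 k S (f ((toC0 k R).symm c))
  map_add' a b := by simp
  map_smul' a c := by
    obtain ⟨c, rfl⟩ := (toC0 k R).surjective c
    induction a using Polynomial.induction_on generalizing c with
    | C a => simp [C_smul_toC0]
    | add p r hp hr => simp only [add_smul, map_add, hp, hr]
    | monomial n a h =>
      have h1 : ∀ c, (toC0 k S (f ((toC0 k R).symm ((Polynomial.X : Polynomial k) •
          toC0 k R c)))) = (Polynomial.X : Polynomial k) • toC0 k S (f c) := by
        intro c
        simp [X_smul_toC0]
      have e : (Polynomial.C a * Polynomial.X ^ (n + 1) : Polynomial k) =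
        (Polynomial.C a * Polynomial.X ^ n) * Polynomial.X := by ring
      rw [e, mul_smul, X_smul_toC0, h, RingHom.id_apply, RingHom.id_apply,
       
        mul_smul _ _ (toC0 k S (f ((toC0 k R).symm (toC0 k R c)))), AddEquiv.symm_apply_apply (toC0 k R) c,
        ← h1, X_smul_toC0]

lemma C0.map_toC0 (f : R →ₐ[Polynomial k] S) (c : R) :
    C0.map k f (toC0 k R c) = toC0 k S (f c) := rfl

/-- The coefficients `e₀ = 1, e₁, e₂, …` of the Carlitz exponential `∑ eᵢ x ^ (q ^ i)`, in a field
extension `L` of `k(t)`; they are determined by `exp (t x) = t exp x + (exp x) ^ q`. -/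
def expCoeff (L : Type u) [Field L] [Algebra (Polynomial k) L] : ℕ → L
  | 0 => 1
  | i + 1 => expCoeff L i ^ Fintype.card k /
      (algebraMap (Polynomial k) L Polynomial.X ^ Fintype.card k ^ (i + 1) -
        algebraMap (Polynomial k) L Polynomial.X)

end CarlitzModule

/-! ### The topology of a fraction field -/

section Topology

variable (R K : Type u) [CommRing R] [Field K] [Algebra R K]

/-- The fractional ideal `a R` in `K`. -/
def fracNhd (a : Kˣ) : AddSubgroup K :=
  (algebraMap R K).range.toAddSubgroup.map (AddMonoidHom.mulLeft (a : K))

variable {R K} in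
lemma mem_fracNhd {a : Kˣ} {x : K} : x ∈ fracNhd R K a ↔ ∃ r : R, (a : K) * algebraMap R K r = x := by
  simp [fracNhd, AddSubgroup.mem_map]

/-- The fractional ideals `a R`, `a ≠ 0`, form a basis of neighbourhoods of zero for a ring
topology on the fraction field `K` of `R`. If `R` is a discrete valuation ring, this is the
topology given by the valuation. -/
lemma fracBasis [IsFractionRing R K] : RingSubgroupsBasis (fracNhd R K) := by
  have hfrac : ∀ x : K, ∃ r s : R, algebraMap R K s ≠ 0 ∧ x * algebraMap R K s = algebraMap R K r := by
    intro x
    obtain ⟨r, s, hs, rfl⟩ := IsFractionRing.div_surjective (A := R) x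
    have : algebraMap R K s ≠ 0 := by
      have := IsLocalization.map_units K ⟨s, hs⟩
      exact this.ne_zero
    exact ⟨r, s, this, div_mul_cancel₀ _ this⟩
  apply RingSubgroupsBasis.of_comm
  · intro a b
    obtain ⟨r, s, hs, h⟩ := hfrac ((a : K) / b)
    refine ⟨a * Units.mk0 _ hs, ?_⟩
    intro x hx
    obtain ⟨y, rfl⟩ := mem_fracNhd.mp hx
    refine ⟨mem_fracNhd.mpr ⟨s * y, by simp [mul_assoc]⟩, mem_fracNhd.mpr ⟨r * y, ?_⟩⟩
    have hb := b.ne_zero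
    rw [map_mul, ← h]
    simp
    field_simp
  · intro a
    obtain ⟨r, s, hs, h⟩ := hfrac (a : K)
    refine ⟨Units.mk0 _ hs * a, ?_⟩
    rintro _ ⟨x, hx, y, hy, rfl⟩
    obtain ⟨x, rfl⟩ := mem_fracNhd.mp hx
    obtain ⟨y, rfl⟩ := mem_fracNhd.mp hy
    refine mem_fracNhd.mpr ⟨s * r * x * y, ?_⟩
    simp only [map_mul, ← h, Units.val_mul, Units.val_mk0]
    ring
  · intro x a
    obtain ⟨r, s, hs, h⟩ := hfrac x
    refine ⟨Units.mk0 _ hs * a, ?_⟩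
    intro y hy
    obtain ⟨y, rfl⟩ := mem_fracNhd.mp hy
    refine mem_fracNhd.mpr ⟨r * y, ?_⟩
    simp only [map_mul, ← h, Units.val_mul, Units.val_mk0]
    ring

end Topology

/-! ### Curves over the projective line -/

section Curve

variable {k : Type u} [Field k] {X : Scheme.{u}} (π : X ⟶ ProjSpace 1 k)

/-- The inverse image `Y ⊆ X` of the affine line `𝐏¹ - ∞`. -/
def finitePart : X.Opens := π ⁻¹ᵁ affineLine k

/-- The points of `X` above `∞`. -/
abbrev AtInfty : Type u := {z : X // z ∉ finitePart π}

/-- The ring `Γ(V, 𝒪_X)` for an open `V ⊆ Y`, to be viewed as a `k[t]`-algebra through `π`. -/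
@[nolint unusedArguments]
def Sec (V : X.Opens) (_hV : V ≤ finitePart π) : Type u := Γ(X, V)

instance (V : X.Opens) (hV : V ≤ finitePart π) : CommRing (Sec π V hV) :=
  inferInstanceAs (CommRing Γ(X, V))

/-- The map `k[t] → Γ(V, 𝒪_X)` induced by `π`. -/
def polyToSec (V : X.Opens) (hV : V ≤ finitePart π) : Polynomial k →+* Γ(X, V) :=
  (π.appLE (affineLine k) V hV).hom.comp (polyToSections k)

instance (V : X.Opens) (hV : V ≤ finitePart π) : Algebra (Polynomial k) (Sec π V hV) :=
  (polyToSec π V hV).toAlgebra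

lemma res_polyToSec {V W : X.Opens} (hV : V ≤ finitePart π) (h : W ≤ V) (a : Polynomial k) :
    X.presheaf.map (homOfLE h).op (polyToSec π V hV a) = polyToSec π W (h.trans hV) a := by
  simp only [polyToSec, RingHom.comp_apply]
  rw [← Scheme.Hom.appLE_map π hV (homOfLE h).op]
  rfl

/-- Restriction of functions. -/
def Sec.res {V W : X.Opens} (hV : V ≤ finitePart π) (hW : W ≤ finitePart π) (h : W ≤ V) :
    Sec π V hV →ₐ[Polynomial k] Sec π W hW :=
  { (X.presheaf.map (homOfLE h).op).hom with
    commutes' := fun a => res_polyToSec π hV h a }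

lemma exists_mem_basicOpen [Surjective π] {a : Polynomial k} (ha : a ≠ 0) :
    ∃ x : X, x ∈ X.basicOpen (polyToSec π (finitePart π) le_rfl a) := by
  have h := basicOpen_polyToSections_ne_bot k ha
  rw [Ne, ← Opens.coe_eq_empty, ← Ne, ← Set.nonempty_iff_ne_empty] at h
  obtain ⟨y, hy⟩ := h
  obtain ⟨x, rfl⟩ := π.surjective y
  have e : polyToSec π (finitePart π) le_rfl a = π.app (affineLine k) (polyToSections k a) := by
    simp only [polyToSec, finitePart, Scheme.Hom.appLE_eq_app]
    rfl
  refine ⟨x, ?_⟩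
  rw [e]
  exact (Scheme.preimage_basicOpen π (polyToSections k a)).le hy

variable [AlgebraicGeometry.IsIntegral X]

lemma genericPoint_mem {U : X.Opens} {z : X} (hz : z ∈ U) : genericPoint X ∈ U :=
  ((genericPoint_spec X).mem_open_set_iff U.isOpen).mpr ⟨z, trivial, hz⟩

lemma genericPoint_mem_finitePart [Surjective π] : genericPoint X ∈ finitePart π := by
  obtain ⟨x, hx⟩ := exists_mem_basicOpen π (one_ne_zero : (1 : Polynomial k) ≠ 0)
  exact genericPoint_mem (X.basicOpen_le _ hx)

/-- The function field `K` of `X`, to be viewed as a `k[t]`-algebra through `π` and as a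
topological field through the local ring at `z`. -/
@[nolint unusedArguments]
def FieldAt (_π : X ⟶ ProjSpace 1 k) (_z : X) : Type u := X.functionField

variable (z : X)

instance : Field (FieldAt π z) := inferInstanceAs (Field X.functionField)

/-- The `z`-adic topology on `K`, with the nonzero fractional ideals of `𝒪_{X,z}` as a basis of
neighbourhoods of zero. -/
instance : TopologicalSpace (FieldAt π z) :=
  (fracBasis (X.presheaf.stalk z) X.functionField).topology

instance : IsTopologicalRing (FieldAt π z) :=
  (fracBasis (X.presheaf.stalk z) X.functionField).toRingFilterBasis.isTopologicalRing

instance : UniformSpace (FieldAt π z) := IsTopologicalAddGroup.rightUniformSpace (FieldAt π z)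

instance : IsUniformAddGroup (FieldAt π z) := isUniformAddGroup_of_addCommGroup

/-- The completion `K_z` of `K` at `z`. -/
def Completed : Type u := UniformSpace.Completion (FieldAt π z)

instance : CommRing (Completed π z) :=
  inferInstanceAs (CommRing (UniformSpace.Completion (FieldAt π z)))

instance : UniformSpace (Completed π z) :=
  inferInstanceAs (UniformSpace (UniformSpace.Completion (FieldAt π z)))

instance : IsTopologicalRing (Completed π z) :=
  inferInstanceAs (IsTopologicalRing (UniformSpace.Completion (FieldAt π z)))

instance : T2Space (Completed π z) :=
  inferInstanceAs (T2Space (UniformSpace.Completion (FieldAt π z)))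

/-- The canonical map `K → K_z`. -/
def toCompleted : FieldAt π z →+* Completed π z := UniformSpace.Completion.coeRingHom

variable [Surjective π]

/-- The map `k[t] → K` induced by `π`. -/
def polyToField : Polynomial k →+* X.functionField :=
  (X.presheaf.germ (finitePart π) (genericPoint X) (genericPoint_mem_finitePart π)).hom.comp
    (polyToSec π (finitePart π) le_rfl)

instance : Algebra (Polynomial k) (FieldAt π z) := (polyToField π).toAlgebra

instance : Algebra (Polynomial k) (Completed π z) :=
  ((toCompleted π z).comp (algebraMap (Polynomial k) (FieldAt π z))).toAlgebra

lemma polyToField_injective : Function.Injective (polyToField π) := by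
  rw [injective_iff_map_eq_zero]
  intro a h
  by_contra ha
  obtain ⟨x, hx⟩ := exists_mem_basicOpen π ha
  have h0 : polyToSec π (finitePart π) le_rfl a = 0 := by
    apply germ_injective_of_isIntegral (X := X) (genericPoint X) (genericPoint_mem_finitePart π)
    rw [map_zero]
    exact h
  rw [h0, Scheme.basicOpen_zero] at hx
  exact hx

/-- The germ map from functions on a nonempty open `V ⊆ Y` to `K_z`. -/
def Sec.toCompleted {V : X.Opens} (hV : V ≤ finitePart π) (hg : genericPoint X ∈ V) :
    Sec π V hV →ₐ[Polynomial k] Completed π z :=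
  { (Carlitz.toCompleted π z).comp (X.presheaf.germ V (genericPoint X) hg).hom with
    commutes' := fun a => by
      change Carlitz.toCompleted π z (X.presheaf.germ V (genericPoint X) hg (polyToSec π V hV a)) =
        Carlitz.toCompleted π z (X.presheaf.germ (finitePart π) (genericPoint X)
          (genericPoint_mem_finitePart π) (polyToSec π (finitePart π) le_rfl a))
      rw [← res_polyToSec π le_rfl hV]
      congr 1
      exact X.presheaf.germ_res_apply (homOfLE hV) (genericPoint X) hg _ }

lemma Sec.toCompleted_res {V W : X.Opens} (hV : V ≤ finitePart π) (hW : W ≤ finitePart π)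
    (h : W ≤ V) (hg : genericPoint X ∈ W) (c : Sec π V hV) :
    Sec.toCompleted π z hW hg (Sec.res π hV hW h c) = Sec.toCompleted π z hV (h hg) c :=
  congrArg (Carlitz.toCompleted π z)
    (X.presheaf.germ_res_apply (homOfLE h) (genericPoint X) hg _)

/-! ### The Carlitz exponential -/

variable [Fintype k]

/-- The terms `eᵢ γ ^ (q ^ i)` of the Carlitz exponential series at `γ ∈ K_z`. -/
def expTerm (γ : Completed π z) (i : ℕ) : Completed π z :=
  toCompleted π z (expCoeff k (FieldAt π z) i) * γ ^ Fintype.card k ^ i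

/-- The relation `exp γ = c`: the Carlitz exponential series converges at `γ`, with sum `c`. -/
def IsExp (γ : Completed π z) (c : C0 k (Completed π z)) : Prop :=
  HasSum (expTerm π z γ) ((toC0 k (Completed π z)).symm c)

/-- The value of the Carlitz exponential at `γ`. -/
def exp (γ : Completed π z) : C0 k (Completed π z) :=
  toC0 k (Completed π z) (∑' i, expTerm π z γ i)

lemma add_pow_card (a b : Completed π z) (i : ℕ) :
    (a + b) ^ Fintype.card k ^ i = a ^ Fintype.card k ^ i + b ^ Fintype.card k ^ i := by
  induction i with
  | zero => simp
  | succ i h =>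
    simp only [pow_succ, pow_mul, h]
    exact map_add (frob k (Completed π z)) _ _

lemma C_pow_card (R : Type u) [CommRing R] [Algebra (Polynomial k) R] (a : k) (i : ℕ) :
    algebraMap (Polynomial k) R (Polynomial.C a) ^ Fintype.card k ^ i =
      algebraMap (Polynomial k) R (Polynomial.C a) := by
  rw [← map_pow, ← map_pow, FiniteField.pow_card_pow]

lemma expCoeff_succ (i : ℕ) : expCoeff k (FieldAt π z) (i + 1) *
      algebraMap (Polynomial k) (FieldAt π z) Polynomial.X ^ Fintype.card k ^ (i + 1) =
    algebraMap (Polynomial k) (FieldAt π z) Polynomial.X * expCoeff k (FieldAt π z) (i + 1) +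
      expCoeff k (FieldAt π z) i ^ Fintype.card k := by
  have hne : algebraMap (Polynomial k) (FieldAt π z) Polynomial.X ^ Fintype.card k ^ (i + 1) -
      algebraMap (Polynomial k) (FieldAt π z) Polynomial.X ≠ 0 := by
    rw [← map_pow, ← map_sub]
    intro h
    have h' := polyToField_injective π (h.trans (map_zero (polyToField π)).symm)
    exact FiniteField.X_pow_card_pow_sub_X_ne_zero k (Nat.succ_ne_zero i)
      Fintype.one_lt_card h'
  rw [expCoeff]
  field_simp
  ring

variable {π z}

lemma IsExp.zero : IsExp π z 0 0 := by
  have : expTerm π z 0 = 0 := by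
    funext i
    simp [expTerm, Fintype.card_ne_zero]
  simp only [IsExp, this, map_zero]
  exact hasSum_zero

lemma IsExp.add {γ γ' : Completed π z} {c c' : C0 k (Completed π z)} (h : IsExp π z γ c)
    (h' : IsExp π z γ' c') : IsExp π z (γ + γ') (c + c') := by
  have : expTerm π z (γ + γ') = fun i => expTerm π z γ i + expTerm π z γ' i := by
    funext i
    simp [expTerm, add_pow_card, mul_add]
  simp only [IsExp, this, map_add]
  exact HasSum.add h h'

lemma IsExp.C_smul {γ : Completed π z} {c : C0 k (Completed π z)} (h : IsExp π z γ c) (a : k) :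
    IsExp π z (Polynomial.C a • γ) (Polynomial.C a • c) := by
  obtain ⟨c, rfl⟩ := (toC0 k _).surjective c
  have : expTerm π z (Polynomial.C a • γ) = fun i =>
      algebraMap (Polynomial k) (Completed π z) (Polynomial.C a) * expTerm π z γ i := by
    funext i
    simp only [expTerm, Algebra.smul_def, mul_pow, C_pow_card]
    ring
  rw [IsExp, this, C_smul_toC0, AddEquiv.symm_apply_apply]
  rw [IsExp, AddEquiv.symm_apply_apply] at h
  exact h.mul_left _

lemma IsExp.X_smul {γ : Completed π z} {c : C0 k (Completed π z)} (h : IsExp π z γ c) :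
    IsExp π z ((Polynomial.X : Polynomial k) • γ) ((Polynomial.X : Polynomial k) • c) := by
  obtain ⟨c, rfl⟩ := (toC0 k _).surjective c
  rw [IsExp, AddEquiv.symm_apply_apply] at h
  rw [IsExp, X_smul_toC0, AddEquiv.symm_apply_apply]
  set t := algebraMap (Polynomial k) (Completed π z) Polynomial.X with ht
  have h1 : HasSum (fun i => t * expTerm π z γ i) (t * c) := h.mul_left _
  have h2 : HasSum (fun i => expTerm π z γ i ^ Fintype.card k) (c ^ Fintype.card k) :=
    HasSum.map h (frob k (Completed π z)) (by
      change Continuous fun x : Completed π z => x ^ Fintype.card k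
      fun_prop)
  let g : ℕ → Completed π z := fun i => Nat.casesOn i 0 fun j => expTerm π z γ j ^ Fintype.card k
  have h3 : HasSum g (c ^ Fintype.card k) := by
    have : HasSum (fun i => g (i + 1)) (c ^ Fintype.card k) := h2
    simpa [g] using this.zero_add
  have : expTerm π z ((Polynomial.X : Polynomial k) • γ) =
      fun i => t * expTerm π z γ i + g i := by
    funext i
    rcases i with _ | i
    · simp [expTerm, g, Algebra.smul_def, expCoeff, ht]
    · have e := congrArg (toCompleted π z) (expCoeff_succ π z i)
      simp only [map_add, map_mul, map_pow] at e
      change _ * t ^ _ = t * _ + _ at e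
      simp only [expTerm, g, Algebra.smul_def, mul_pow, ← ht]
      rw [← mul_assoc, e, add_mul, ← pow_mul, ← pow_succ]
      ring
  rw [this]
  exact h1.add h3

lemma IsExp.smul {γ : Completed π z} {c : C0 k (Completed π z)} (h : IsExp π z γ c)
    (a : Polynomial k) : IsExp π z (a • γ) (a • c) := by
  induction a using Polynomial.induction_on generalizing γ c with
  | C a => exact h.C_smul a
  | add p r hp hr =>
    rw [add_smul, add_smul]
    exact (hp h).add (hr h)
  | monomial n a hn =>
    have e : (Polynomial.C a * Polynomial.X ^ (n + 1) : Polynomial k) =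
      (Polynomial.C a * Polynomial.X ^ n) * Polynomial.X := by ring
    have hX := h.X_smul
    have h2 := hn hX
    rw [← mul_smul, ← mul_smul, ← e] at h2
    exact h2

variable (π)

/-! ### The sheaf `C` -/

/-- The points of an open `U` that lie above `∞`. -/
abbrev InftyIn (U : X.Opens) : Type u := {z : AtInfty π // z.1 ∈ U}

/-- The module `C₀(U ∩ Y) × ∏_{z ∈ U \ Y} K_z`. -/
abbrev Pairs (U : X.Opens) : Type u :=
  C0 k (Sec π (U ⊓ finitePart π) inf_le_right) × ∀ z : InftyIn π U, Completed π z.1.1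

/-- The image in `C₀(K_z)` of an element of `C₀(U ∩ Y)`, for a point `z` of `U`. -/
def localize {U : X.Opens} (z : InftyIn π U) :
    C0 k (Sec π (U ⊓ finitePart π) inf_le_right) →ₗ[Polynomial k] C0 k (Completed π z.1.1) :=
  C0.map k (Sec.toCompleted π z.1.1 inf_le_right
    ⟨genericPoint_mem z.2, genericPoint_mem_finitePart π⟩)

/-- The module `C(U)` of pairs `(c, (γ_z)_z)` with `exp γ_z = c` for all `z`. -/
def carlitzSections (U : X.Opens) : Submodule (Polynomial k) (Pairs π U) where
  carrier := {s | ∀ z : InftyIn π U, IsExp π z.1.1 (s.2 z) (localize π z s.1)}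
  zero_mem' z := by
    simpa using IsExp.zero
  add_mem' {s s'} h h' z := by
    simpa using (h z).add (h' z)
  smul_mem' a s h z := by
    simpa using (h z).smul a

/-- Restriction `C₀(U ∩ Y) × ∏_{z ∈ U \ Y} K_z → C₀(V ∩ Y) × ∏_{z ∈ V \ Y} K_z`. -/
def Pairs.res {U V : X.Opens} (h : V ≤ U) : Pairs π U →ₗ[Polynomial k] Pairs π V where
  toFun s := (C0.map k (Sec.res π inf_le_right inf_le_right (inf_le_inf_right _ h)) s.1,
    fun z => s.2 ⟨z.1, h z.2⟩)
  map_add' s s' := by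
    ext <;> simp
  map_smul' a s := by
    ext <;> simp

lemma localize_res {U V : X.Opens} (h : V ≤ U) (s : Pairs π U) (z : InftyIn π V) :
    localize π z (Pairs.res π h s).1 = localize π (U := U) ⟨z.1, h z.2⟩ s.1 :=
  Sec.toCompleted_res π z.1.1 inf_le_right inf_le_right (inf_le_inf_right _ h) _ _

/-- The presheaf `U ↦ C(U)` of `k[t]`-modules. -/
def carlitzPresheaf : TopCat.Presheaf (ModuleCat.{u} (Polynomial k)) X where
  obj U := ModuleCat.of (Polynomial k) (carlitzSections π U.unop)
  map {U V} f := ModuleCat.ofHom ((Pairs.res π f.unop.le).restrict (fun s hs z => by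
    rw [localize_res]
    exact hs ⟨z.1, f.unop.le z.2⟩))
  map_id U := by
    refine ModuleCat.hom_ext (LinearMap.ext fun s => Subtype.ext (Prod.ext ?_ rfl))
    exact ConcreteCategory.congr_hom (X.presheaf.map_id _) s.1.1
  map_comp {U V W} f g := by
    refine ModuleCat.hom_ext (LinearMap.ext fun s => Subtype.ext (Prod.ext ?_ rfl))
    exact ConcreteCategory.congr_hom (X.presheaf.map_comp
      (homOfLE (inf_le_inf_right (finitePart π) f.unop.le)).op
      (homOfLE (inf_le_inf_right (finitePart π) g.unop.le)).op) s.1.1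

lemma carlitzPresheaf_isSheaf : (carlitzPresheaf (k := k) π).IsSheaf := by
  rw [TopCat.Presheaf.isSheaf_iff_isSheafUniqueGluing]
  intro ι U sf hsf
  let s : ∀ i, Pairs π (U i) := fun i => (sf i).1
  have hs : ∀ i, s i ∈ carlitzSections π (U i) := fun i => (sf i).2
  have hc : ∀ i j, Pairs.res π (inf_le_left : U i ⊓ U j ≤ U i) (s i) =
      Pairs.res π (inf_le_right : U i ⊓ U j ≤ U j) (s j) := fun i j =>
    congrArg Subtype.val (hsf i j)
  let V : ι → X.Opens := fun i => U i ⊓ finitePart π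
  have hle : ∀ i, V i ≤ iSup U ⊓ finitePart π := fun i => inf_le_inf_right _ (le_iSup U i)
  have hcov : iSup U ⊓ finitePart π ≤ iSup V := by rw [iSup_inf_eq]
  let c : ∀ i, Γ(X, V i) := fun i => (s i).1
  have hcc : ∀ i j, X.presheaf.map (homOfLE (inf_le_left : V i ⊓ V j ≤ V i)).op (c i) =
      X.presheaf.map (homOfLE (inf_le_right : V i ⊓ V j ≤ V j)).op (c j) := by
    intro i j
    have h1 : X.presheaf.map (homOfLE (inf_le_inf_right (finitePart π)
          (inf_le_left : U i ⊓ U j ≤ U i))).op (c i) =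
        X.presheaf.map (homOfLE (inf_le_inf_right (finitePart π)
          (inf_le_right : U i ⊓ U j ≤ U j))).op (c j) := congrArg Prod.fst (hc i j)
    have hW : V i ⊓ V j ≤ (U i ⊓ U j) ⊓ finitePart π :=
      le_inf (inf_le_inf inf_le_left inf_le_left) (inf_le_left.trans inf_le_right)
    have h2 := congrArg (X.presheaf.map (homOfLE hW).op) h1
    rw [← ConcreteCategory.comp_apply, ← ConcreteCategory.comp_apply, ← Functor.map_comp,
      ← Functor.map_comp] at h2
    exact h2
  obtain ⟨c₀, hc₀, huniq⟩ := X.sheaf.existsUnique_gluing' V (iSup U ⊓ finitePart π)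
    (fun i => homOfLE (hle i)) hcov c hcc
  have hex : ∀ z : InftyIn π (iSup U), ∃ i, z.1.1 ∈ U i := fun z => Opens.mem_iSup.mp z.2
  choose idx hidx using hex
  let γ : ∀ z : InftyIn π (iSup U), Completed π z.1.1 := fun z => (s (idx z)).2 ⟨z.1, hidx z⟩
  have hγ : ∀ (z : InftyIn π (iSup U)) (i : ι) (hz : z.1.1 ∈ U i),
      γ z = (s i).2 ⟨z.1, hz⟩ := fun z i hz =>
    congrFun (congrArg Prod.snd (hc (idx z) i)) ⟨z.1, hidx z, hz⟩
  let σ : Pairs π (iSup U) := (c₀, γ)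
  have hres : ∀ i, Pairs.res π (le_iSup U i) σ = s i := by
    intro i
    refine Prod.ext (hc₀ i) (funext fun z => ?_)
    exact hγ ⟨z.1, le_iSup U i z.2⟩ i z.2
  have hσ : σ ∈ carlitzSections π (iSup U) := by
    intro z
    have h := hs (idx z) ⟨z.1, hidx z⟩
    rw [← hres (idx z), localize_res] at h
    exact h
  refine ⟨⟨σ, hσ⟩, fun i => Subtype.ext (hres i), ?_⟩
  rintro ⟨τ, hτ⟩ h
  have hτ' : ∀ i, Pairs.res π (le_iSup U i) τ = s i := fun i => congrArg Subtype.val (h i)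
  refine Subtype.ext (Prod.ext (huniq τ.1 fun i => congrArg Prod.fst (hτ' i)) (funext fun z => ?_))
  exact congrFun (congrArg Prod.snd (hτ' (idx z))) ⟨z.1, hidx z⟩

/-- The sheaf `C` of `k[t]`-modules on `X`. -/
def carlitzSheaf : Sheaf (Opens.grothendieckTopology X) (ModuleCat.{u} (Polynomial k)) :=
  ⟨carlitzPresheaf π, carlitzPresheaf_isSheaf π⟩

/-- `C₀(Y)`. -/
abbrev C0Y : Type u := C0 k (Sec π (finitePart π) le_rfl)

/-- The inclusion `C(X) → C₀(Y) × ∏_{z ∈ X \ Y} K_z`. -/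
def globalInclusion : (carlitzSheaf (k := k) π).obj.obj (op ⊤) →ₗ[Polynomial k]
    C0Y (k := k) π × ∀ z : AtInfty π, Completed π z.1 where
  toFun s := (C0.map k (Sec.res π inf_le_right le_rfl (le_inf le_top le_rfl)) s.1.1,
    fun z => s.1.2 ⟨z, trivial⟩)
  map_add' s s' := by
    refine Prod.ext ?_ rfl
    exact map_add _ s.1.1 s'.1.1
  map_smul' a s := by
    refine Prod.ext ?_ rfl
    exact map_smul _ a s.1.1

/-- The natural map `C₀(Y) → C₀(K_z)`. -/
def localizeY (z : X) : C0Y (k := k) π →ₗ[Polynomial k] C0 k (Completed π z) :=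
  C0.map k (Sec.toCompleted π z le_rfl (genericPoint_mem_finitePart π))

end Curve

/-! ### Sheaf cohomology -/

/-- The cohomology `Hⁿ(T, F)` of a sheaf `F` of `A`-modules on a topological space `T`, with its
`A`-module structure, as the `n`-th derived functor of `Γ(T, -) = Hom(A_T, -)`, where `A_T` is the
constant sheaf. -/
abbrev cohomology {A : Type u} [CommRing A] {T : TopCat.{u}}
    (F : Sheaf (Opens.grothendieckTopology T) (ModuleCat.{u} A)) (n : ℕ) : Type u :=
  Abelian.Ext ((constantSheaf (Opens.grothendieckTopology T) (ModuleCat.{u} A)).obj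
    (ModuleCat.of A A)) F n

end Carlitz

end

/-! Write P(U) = C₀(U ∩ Y) × ∏ K_z and Q(U) = ∏ C₀(K_z), the products over z ∈ U \ Y. By definition
C is the kernel of the difference map P → Q. Once this map is an epimorphism of sheaves and H¹(X, P)
= 0, the long exact sequence of Ext(A_X, -) is the assertion.

Epimorphism. At z above ∞ the function s = 1/t lies in the maximal ideal of the local ring, and the
recursion for the coefficients gives e_i = r_i s^(i q^i) with r_i in the local ring
(`exists_expCoeff_eq`). Hence exp converges on K_z. On the closure O of the local ring it is the
identity plus a map that contracts the filtration s^n O, so its image contains O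
(`exists_hasSum_exp`). As K is dense and O is open, K_z = K + exp K_z. An element of K is regular on
a punctured neighbourhood of z, which is all that a section of P near z needs (`exists_diffOn_eq`).

Vanishing. It suffices to split Čech 1-cocycles of P after refinement. The C₀-component splits
because Y is affine (`exists_sub_isRegularOn`), and the K_z-components split by an explicit formula
(`pairsSheaf_cechAcyclic`). Y is affine because π is proper with finite fibres, hence finite; the
fibres are finite because every point of a smooth curve is closed or generic (`eq_of_specializes`).
-/

noncomputable section

attribute [local instance] MvPolynomial.gradedAlgebra

/-! ### Sheaf cohomology: sections as Hom(A_T, -), a Čech criterion for H¹ = 0, the connecting map.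
-/

namespace SheafCohomology

variable {A : Type u} [CommRing A] {T : TopCat.{u}}

/-- Sheaves of `A`-modules on a topological space. -/
abbrev ModSheaf (A : Type u) [CommRing A] (T : TopCat.{u}) :=
  Sheaf (Opens.grothendieckTopology T) (ModuleCat.{u} A)

/-- The constant sheaf `A_T`. -/
abbrev constSheaf (A : Type u) [CommRing A] (T : TopCat.{u}) : ModSheaf A T :=
  (constantSheaf (Opens.grothendieckTopology T) (ModuleCat.{u} A)).obj (ModuleCat.of A A)

/-- The adjunction between constant sheaves and global sections. -/
abbrev constAdj (A : Type u) [CommRing A] (T : TopCat.{u}) :=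
  constantSheafAdj (Opens.grothendieckTopology T) (ModuleCat.{u} A)
    (Preorder.isTerminalTop (Opens T))

/-- The global section of `F` that corresponds to a morphism `A_T ⟶ F`. -/
def homToSection (F : ModSheaf A T) : (constSheaf A T ⟶ F) →ₗ[A] F.obj.obj (op ⊤) where
  toFun f := ((constAdj A T).homEquiv _ _ f).hom (1 : A)
  map_add' f g := by
    simp only [Adjunction.homEquiv_unit]
    rfl
  map_smul' a f := by
    simp only [Adjunction.homEquiv_unit]
    rfl

/-- Constant sheaves are left adjoint to global sections, and a linear map out of A is determined by
its value at 1, which is arbitrary. -/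
lemma homToSection_bijective (F : ModSheaf A T) : Function.Bijective (homToSection F) := by
  constructor
  · intro f g h
    apply ((constAdj A T).homEquiv _ _).injective
    exact ModuleCat.hom_ext (LinearMap.ext_ring h)
  · intro s
    let g : ModuleCat.of A A ⟶ F.obj.obj (op ⊤) :=
      ModuleCat.ofHom (LinearMap.toSpanSingleton A _ s)
    exact ⟨((constAdj A T).homEquiv (ModuleCat.of A A) F).symm g,
      (congrArg (fun h : ModuleCat.of A A ⟶ F.obj.obj (op ⊤) => h.hom (1 : A))
        (((constAdj A T).homEquiv (ModuleCat.of A A) F).apply_symm_apply g)).trans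
        (LinearMap.toSpanSingleton_apply_one A _ s)⟩

/-- `Hom(A_T, F) = Γ(T, F)`. -/
def homEquivSections (F : ModSheaf A T) : (constSheaf A T ⟶ F) ≃ₗ[A] F.obj.obj (op ⊤) :=
  LinearEquiv.ofBijective (homToSection F) (homToSection_bijective F)

lemma homEquivSections_comp {F G : ModSheaf A T} (f : constSheaf A T ⟶ F) (g : F ⟶ G) :
    homEquivSections G (f ≫ g) = g.hom.app (op ⊤) (homEquivSections F f) := by
  change ((constAdj A T).homEquiv (ModuleCat.of A A) _ (f ≫ g)).hom (1 : A) = _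
  rw [Adjunction.homEquiv_naturality_right]
  rfl

/-- Taking sections over U is left exact. -/
lemma exists_section_of_exact {S : ShortComplex (ModSheaf A T)} (hS : S.Exact) [Mono S.f]
    {U : Opens T} (s : S.X₂.obj.obj (op U)) (hs : S.g.hom.app (op U) s = 0) :
    ∃ t : S.X₁.obj.obj (op U), S.f.hom.app (op U) t = s := by
  let F := sheafToPresheaf (Opens.grothendieckTopology T) (ModuleCat.{u} A) ⋙
    (evaluation (Opens T)ᵒᵖ (ModuleCat.{u} A)).obj (op U)
  have h : (S.map F).Exact :=
    ((F.preservesFiniteLimits_tfae.out 1 3 rfl rfl).mpr inferInstance S ⟨hS, inferInstance⟩).1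
  exact (ShortComplex.moduleCat_exact_iff _).mp h s hs

lemma exists_local_lift {F G : ModSheaf A T} (f : F ⟶ G) [Epi f] {U : Opens T}
    (s : G.obj.obj (op U)) (x : T) (hx : x ∈ U) :
    ∃ (V : Opens T) (h : V ≤ U) (t : F.obj.obj (op V)), x ∈ V ∧
      f.hom.app (op V) t = G.obj.map (homOfLE h).op s := by
  have h := (TopCat.Sheaf.isLocallySurjective_iff_epi f).mpr ‹Epi f›
  obtain ⟨V, hV, ⟨t, ht⟩, hx⟩ := (TopCat.Presheaf.isLocallySurjective_iff f.hom).mp h U s x hx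
  exact ⟨V, hV, t, hx, ht⟩


/-- Restriction of sections. -/
def res (F : ModSheaf A T) {U V : Opens T} (h : V ≤ U) :
    F.obj.obj (op U) →ₗ[A] F.obj.obj (op V) :=
  (F.obj.map (homOfLE h).op).hom

lemma res_res (F : ModSheaf A T) {U V W : Opens T} (h : V ≤ U) (h' : W ≤ V)
    (s : F.obj.obj (op U)) : res F h' (res F h s) = res F (h'.trans h) s :=
  (ConcreteCategory.congr_hom (F.obj.map_comp (homOfLE h).op (homOfLE h').op) s).symm

lemma map_res {F G : ModSheaf A T} (f : F ⟶ G) {U V : Opens T} (h : V ≤ U)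
    (s : F.obj.obj (op U)) : f.hom.app (op V) (res F h s) = res G h (f.hom.app (op U) s) :=
  ConcreteCategory.congr_hom (f.hom.naturality (homOfLE h).op) s

lemma app_injective {F G : ModSheaf A T} (f : F ⟶ G) [Mono f] (U : Opens T) :
    Function.Injective (f.hom.app (op U)) := by
  have h : Mono ((sheafToPresheaf _ _).map f) := inferInstance
  rw [NatTrans.mono_iff_mono_app] at h
  exact (ModuleCat.mono_iff_injective _).mp (h (op U))

/-- Every Čech 1-cocycle of `F` becomes a coboundary after a refinement of the covering. -/
def CechAcyclic (F : ModSheaf A T) : Prop :=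
  ∀ (U : T → Opens T) (_ : ∀ x, x ∈ U x) (f : ∀ x y, F.obj.obj (op (U x ⊓ U y)))
    (_ : ∀ x y z (W : Opens T) (hxy : W ≤ U x ⊓ U y) (hyz : W ≤ U y ⊓ U z) (hxz : W ≤ U x ⊓ U z),
      res F hxy (f x y) + res F hyz (f y z) = res F hxz (f x z)),
    ∃ (V : T → Opens T) (hVU : ∀ x, V x ≤ U x) (_ : ∀ x, x ∈ V x)
      (g : ∀ x, F.obj.obj (op (V x))),
      ∀ x y, res F (inf_le_inf (hVU x) (hVU y)) (f x y) =
        res F inf_le_left (g x) - res F inf_le_right (g y)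

/-- Local lifts t_x of s differ by sections of `S.X₁`, which form a cocycle. Once this is the
coboundary of some g on a refinement, the corrected lifts t_x - g_x agree on overlaps and glue.
Coverings are indexed by the points of T, so a refinement involves no map of index sets. -/
lemma CechAcyclic.surjective_sections {S : ShortComplex (ModSheaf A T)} (hS : S.ShortExact)
    (h : CechAcyclic S.X₁) : Function.Surjective (S.g.hom.app (op ⊤)) := by
  have := hS.mono_f
  have := hS.epi_g
  have hfg : ∀ (U : Opens T) (t : S.X₁.obj.obj (op U)),
      S.g.hom.app (op U) (S.f.hom.app (op U) t) = 0 := by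
    intro U t
    have e := congrArg (fun φ : S.X₁ ⟶ S.X₃ => φ.hom.app (op U) t) S.zero
    exact e
  intro s
  choose U hU t hx ht using fun x : T => exists_local_lift S.g s x trivial
  have hd : ∀ x y, ∃ f : S.X₁.obj.obj (op (U x ⊓ U y)), S.f.hom.app (op (U x ⊓ U y)) f =
      res S.X₂ inf_le_left (t x) - res S.X₂ inf_le_right (t y) := by
    intro x y
    apply exists_section_of_exact hS.exact
    rw [map_sub, map_res, map_res, ht, ht]
    change res S.X₃ _ (res S.X₃ _ s) - res S.X₃ _ (res S.X₃ _ s) = 0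
    rw [res_res, res_res, sub_self]
  choose f hf using hd
  obtain ⟨V, hVU, hV, g, hg⟩ := h U hx f (by
    intro x y z W hxy hyz hxz
    apply app_injective S.f W
    rw [map_add, map_res, map_res, map_res, hf, hf, hf]
    simp only [map_sub, res_res]
    abel)
  let t' : ∀ x, S.X₂.obj.obj (op (V x)) := fun x =>
    res S.X₂ (hVU x) (t x) - S.f.hom.app (op (V x)) (g x)
  have hcov : (⊤ : Opens T) ≤ iSup V := fun x _ => Opens.mem_iSup.mpr ⟨x, hV x⟩
  obtain ⟨r, hr, -⟩ := TopCat.Sheaf.existsUnique_gluing' S.X₂ V ⊤ (fun x => homOfLE le_top) hcov t'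
    (by
      intro x y
      change res S.X₂ inf_le_left _ = res S.X₂ inf_le_right _
      have e := congrArg (S.f.hom.app (op (V x ⊓ V y))) (hg x y)
      rw [map_res, hf, map_sub, map_sub, map_res, map_res, res_res, res_res] at e
      simp only [t', map_sub, res_res]
      rw [sub_eq_sub_iff_sub_eq_sub]
      exact e)
  refine ⟨r, ?_⟩
  apply TopCat.Sheaf.eq_of_locally_eq' S.X₃ V ⊤ (fun x => homOfLE le_top) hcov
  intro x
  have h1 : res S.X₂ le_top r = t' x := hr x
  change res S.X₃ le_top _ = res S.X₃ le_top _
  rw [← map_res, h1]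
  simp only [t', map_sub]
  rw [hfg, sub_zero, map_res, ht]
  exact res_res _ _ _ _

/-- Embed F in an injective sheaf I. Since Ext¹(A_T, I) = 0, every class comes from a global section
of I/F; that section lifts to I, so the class is zero. -/
lemma CechAcyclic.ext_one_eq_zero {F : ModSheaf A T} (h : CechAcyclic F)
    (x : Carlitz.cohomology F 1) : x = 0 := by
  let S : ShortComplex (ModSheaf A T) := ShortComplex.mk (Injective.ι F)
    (Limits.cokernel.π (Injective.ι F)) (Limits.cokernel.condition _)
  have hS : S.ShortExact :=
    { exact := ShortComplex.exact_of_g_is_cokernel _ (Limits.cokernelIsCokernel _)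
      mono_f := inferInstanceAs (Mono (Injective.ι F))
      epi_g := inferInstanceAs (Epi (Limits.cokernel.π _)) }
  have hI : Injective S.X₂ := inferInstanceAs (Injective (Injective.under F))
  obtain ⟨y, hy⟩ := Abelian.Ext.covariant_sequence_exact₁ _ hS x
    (Abelian.Ext.eq_zero_of_injective _) (zero_add 1)
  obtain ⟨g, rfl⟩ := (Abelian.Ext.mk₀_bijective _ _).2 y
  obtain ⟨r, hr⟩ := h.surjective_sections (S := S) hS (homEquivSections _ g)
  have hg : (homEquivSections _).symm r ≫ S.g = g := by
    apply (homEquivSections _).injective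
    rw [homEquivSections_comp, LinearEquiv.apply_symm_apply, hr]
  rw [← hy, ← hg, ← Abelian.Ext.mk₀_comp_mk₀_assoc, hS.comp_extClass]
  simp

/-- The connecting homomorphism `Γ(T, F₃) → H¹(T, F₁)`. -/
def connecting {S : ShortComplex (ModSheaf A T)} (hS : S.ShortExact) :
    S.X₃.obj.obj (op ⊤) →ₗ[A] Carlitz.cohomology S.X₁ 1 where
  toFun s := (Abelian.Ext.mk₀ ((homEquivSections S.X₃).symm s)).comp hS.extClass (zero_add 1)
  map_add' s s' := by
    rw [map_add, Abelian.Ext.mk₀_add, Abelian.Ext.add_comp]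
  map_smul' a s := by
    rw [map_smul, Abelian.Ext.mk₀_smul, Abelian.Ext.smul_comp, RingHom.id_apply]

lemma connecting_exact {S : ShortComplex (ModSheaf A T)} (hS : S.ShortExact) :
    Function.Exact (S.g.hom.app (op ⊤)) (connecting hS) := by
  intro s
  constructor
  · intro h
    obtain ⟨y, hy⟩ := Abelian.Ext.covariant_sequence_exact₃ _ hS _ (zero_add 1) h
    obtain ⟨g, rfl⟩ := (Abelian.Ext.mk₀_bijective _ _).2 y
    refine ⟨homEquivSections _ g, ?_⟩
    rw [Abelian.Ext.mk₀_comp_mk₀] at hy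
    have := (Abelian.Ext.mk₀_bijective _ _).1 hy
    rw [← homEquivSections_comp, this, LinearEquiv.apply_symm_apply]
  · rintro ⟨r, rfl⟩
    have hg : (homEquivSections S.X₃).symm (S.g.hom.app (op ⊤) r) =
        (homEquivSections S.X₂).symm r ≫ S.g := by
      apply (homEquivSections _).injective
      rw [homEquivSections_comp, LinearEquiv.apply_symm_apply, LinearEquiv.apply_symm_apply]
    change (Abelian.Ext.mk₀ ((homEquivSections S.X₃).symm _)).comp hS.extClass (zero_add 1) = 0
    rw [hg, ← Abelian.Ext.mk₀_comp_mk₀_assoc, hS.comp_extClass]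
    simp

/-- The next term of the long exact sequence is H¹ of `S.X₂`, which vanishes. -/
lemma connecting_surjective {S : ShortComplex (ModSheaf A T)} (hS : S.ShortExact)
    (h : CechAcyclic S.X₂) : Function.Surjective (connecting hS) := by
  intro x
  obtain ⟨y, hy⟩ := Abelian.Ext.covariant_sequence_exact₁ _ hS x (h.ext_one_eq_zero _) (zero_add 1)
  obtain ⟨g, rfl⟩ := (Abelian.Ext.mk₀_bijective _ _).2 y
  refine ⟨homEquivSections _ g, ?_⟩
  change (Abelian.Ext.mk₀ ((homEquivSections S.X₃).symm _)).comp hS.extClass (zero_add 1) = x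
  rw [LinearEquiv.symm_apply_apply, hy]

end SheafCohomology

/-! ### Series in complete nonarchimedean groups and rings. -/

namespace AdicExp

open Filter Topology

section Group

variable {L : Type*} [AddCommGroup L] [UniformSpace L] [IsUniformAddGroup L]
  {U : ℕ → AddSubgroup L} (hU : (𝓝 (0 : L)).HasBasis (fun _ => True) fun n => (U n : Set L))

include hU

lemma isOpen_of_basis (n : ℕ) : IsOpen (U n : Set L) :=
  (U n).isOpen_of_mem_nhds (hU.mem_of_mem trivial)

lemma isClosed_of_basis (n : ℕ) : IsClosed (U n : Set L) :=
  AddSubgroup.isClosed_of_isOpen _ (isOpen_of_basis hU n)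

lemma nonarchimedean_of_basis : NonarchimedeanAddGroup L where
  is_nonarchimedean V hV := by
    obtain ⟨n, -, hn⟩ := hU.mem_iff.mp hV
    exact ⟨⟨U n, isOpen_of_basis hU n⟩, hn⟩

/-- In a complete nonarchimedean group a series converges as soon as its terms tend to zero. The
shift N leaves room for the denominator of the argument of exp. -/
lemma summable_of_mem [CompleteSpace L] (hanti : Antitone U) {f : ℕ → L} (N : ℕ)
    (hf : ∀ i, f (i + N) ∈ U i) : Summable f := by
  have := nonarchimedean_of_basis hU
  refine NonarchimedeanAddGroup.summable_of_tendsto_cofinite_zero ?_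
  rw [Nat.cofinite_eq_atTop, hU.tendsto_right_iff]
  intro n _
  filter_upwards [eventually_ge_atTop (n + N)] with i hi
  obtain ⟨j, rfl⟩ := Nat.exists_eq_add_of_le' (le_of_add_le_right hi)
  exact hanti (by omega) (hf j)

lemma hasSum_mem {f : ℕ → L} {a : L} (h : HasSum f a) {n : ℕ} (hf : ∀ i, f i ∈ U n) : a ∈ U n :=
  (isClosed_of_basis hU n).mem_of_tendsto h (Eventually.of_forall fun _ => (U n).sum_mem fun i _ => hf i)

/-- The Neumann series x = ∑ (-h)^n c converges, its n-th term being in `U n`. Applying -h termwise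
drops the first term, so -h x = x - c. -/
lemma exists_add_eq_of_contracting [CompleteSpace L] [T2Space L] (hanti : Antitone U) (h : L →+ L)
    (hh : ∀ n, ∀ x ∈ U n, h x ∈ U (n + 1)) {c : L} (hc : c ∈ U 0) : ∃ x : L, x + h x = c := by
  have hcont : Continuous h := by
    refine continuous_of_continuousAt_zero h ?_
    rw [ContinuousAt, map_zero, hU.tendsto_iff hU]
    exact fun n _ => ⟨n, trivial, fun x hx => hanti (Nat.le_succ n) (hh n x hx)⟩
  let f : ℕ → L := fun n => (fun x => - h x)^[n] c
  have hf : ∀ n, f n ∈ U n := by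
    intro n
    induction n with
    | zero => exact hc
    | succ n ih =>
      simp only [f, Function.iterate_succ_apply']
      exact (U (n + 1)).neg_mem (hh n _ ih)
  obtain ⟨x, hx⟩ := summable_of_mem hU hanti 0 (f := f) hf
  refine ⟨x, ?_⟩
  have h1 : HasSum (fun n => f (n + 1)) (- h x) := by
    have : HasSum (fun n => - h (f n)) (- h x) := (hx.map h hcont).neg
    refine this.congr_fun ?_
    intro n
    simp only [f, Function.iterate_succ_apply']
  have h2 := h1.zero_add
  have := h2.unique hx
  have h0 : f 0 = c := rfl
  rw [h0] at this
  nth_rewrite 1 [← this]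
  abel

end Group

section Ring

variable {L : Type*} [CommRing L]

/-- The subgroup `s ^ n O`. -/
def powNhd (O : Subring L) (s : L) (n : ℕ) : AddSubgroup L :=
  O.toAddSubgroup.map (AddMonoidHom.mulLeft (s ^ n))

lemma mem_powNhd {O : Subring L} {s : L} {n : ℕ} {x : L} :
    x ∈ powNhd O s n ↔ ∃ y ∈ O, s ^ n * y = x := by
  simp [powNhd, AddSubgroup.mem_map]

lemma powNhd_antitone {O : Subring L} {s : L} (hs : s ∈ O) : Antitone (powNhd O s) := by
  intro m n hmn x hx
  obtain ⟨y, hy, rfl⟩ := mem_powNhd.mp hx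
  obtain ⟨d, rfl⟩ := Nat.exists_eq_add_of_le hmn
  exact mem_powNhd.mpr ⟨s ^ d * y, O.mul_mem (O.pow_mem hs d) hy, by ring⟩

variable [UniformSpace L] [IsUniformAddGroup L] [IsTopologicalRing L] {O : Subring L} {s : L}
  (hs : s ∈ O) (hU : (𝓝 (0 : L)).HasBasis (fun _ => True) fun n => (powNhd O s n : Set L))
  {u : ℕ → L} (hu : ∀ i, u i ∈ O) {q : ℕ} (hq : 0 < q)

include hU

-- Multiplication by x is continuous at zero, so it maps some s^n O into O; apply this to s^n
-- itself.
omit [IsUniformAddGroup L] in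
lemma exists_pow_mul_mem (x : L) : ∃ n, s ^ n * x ∈ O := by
  have h : Tendsto (fun y => y * x) (𝓝 (0 : L)) (𝓝 0) := by
    have : Continuous fun y : L => y * x := by fun_prop
    simpa using this.tendsto 0
  obtain ⟨n, -, hn⟩ := (hU.tendsto_iff hU).mp h 0 trivial
  obtain ⟨y, hy, h⟩ := mem_powNhd.mp (hn (s ^ n) (mem_powNhd.mpr ⟨1, O.one_mem, mul_one _⟩))
  refine ⟨n, ?_⟩
  rw [← h]
  simpa using hy

include hs hu hq

/-- If s^N x ∈ O, then s^(N q^(i+N)) clears the denominator of the term of index i + N, and of its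
exponent (i + N) q^(i+N) there remains i q^(i+N) ≥ i. -/
lemma summable_exp [CompleteSpace L] (x : L) :
    Summable fun i => u i * s ^ (i * q ^ i) * x ^ q ^ i := by
  obtain ⟨N, hN⟩ := exists_pow_mul_mem hU x
  refine summable_of_mem hU (powNhd_antitone hs) N fun i => ?_
  have h : i ≤ i * q ^ (i + N) := Nat.le_mul_of_pos_right _ (by positivity)
  refine powNhd_antitone hs h (mem_powNhd.mpr
    ⟨u (i + N) * (s ^ N * x) ^ q ^ (i + N), O.mul_mem (hu _) (O.pow_mem hN _), ?_⟩)
  ring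

/-- The series is x + h x, where h collects the terms of positive index and is additive by `hadd`.
On s^n O the term of index i + 1 is divisible by s to the power (i + 1 + n) q^(i+1) ≥ n + 1, so h is
contracting. -/
lemma exists_hasSum_exp [CompleteSpace L] [T2Space L] (hu0 : u 0 = 1)
    (hadd : ∀ (x y : L) (i : ℕ), (x + y) ^ q ^ i = x ^ q ^ i + y ^ q ^ i) {c : L} (hc : c ∈ O) :
    ∃ x, HasSum (fun i => u i * s ^ (i * q ^ i) * x ^ q ^ i) c := by
  have hsum : ∀ x, Summable fun i => u (i + 1) * s ^ ((i + 1) * q ^ (i + 1)) * x ^ q ^ (i + 1) :=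
    fun x => (summable_nat_add_iff 1).mpr (summable_exp hs hU hu hq x)
  let h : L →+ L :=
    { toFun := fun x => ∑' i, u (i + 1) * s ^ ((i + 1) * q ^ (i + 1)) * x ^ q ^ (i + 1)
      map_zero' := by
        simp [hq.ne']
      map_add' := fun x y => by
        rw [← (hsum x).tsum_add (hsum y)]
        simp only [hadd, mul_add] }
  have hh : ∀ n, ∀ x ∈ powNhd O s n, h x ∈ powNhd O s (n + 1) := by
    intro n x hx
    obtain ⟨y, hy, rfl⟩ := mem_powNhd.mp hx
    refine hasSum_mem hU (hsum _).hasSum fun i => ?_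
    have h : n + 1 ≤ (i + 1 + n) * q ^ (i + 1) :=
      le_trans (by omega) (Nat.le_mul_of_pos_right _ (by positivity))
    refine powNhd_antitone hs h (mem_powNhd.mpr
      ⟨u (i + 1) * y ^ q ^ (i + 1), O.mul_mem (hu _) (O.pow_mem hy _), ?_⟩)
    ring
  obtain ⟨x, hx⟩ := exists_add_eq_of_contracting hU (powNhd_antitone hs) h hh (c := c)
    (mem_powNhd.mpr ⟨c, hc, by simp⟩)
  refine ⟨x, ?_⟩
  have h1 := (hsum x).hasSum.zero_add (f := fun i => u i * s ^ (i * q ^ i) * x ^ q ^ i)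
  have e : u 0 * s ^ (0 * q ^ 0) * x ^ q ^ 0 = x := by simp [hu0]
  rw [e] at h1
  rwa [← hx]

end Ring

/-! ### The topology of the completion and the size of the Carlitz coefficients. -/

section Completion

variable {R K L : Type u} [CommRing R] [Field K] [Algebra R K] [TopologicalSpace K]
  [CommRing L] [TopologicalSpace L] [IsTopologicalRing L] [T3Space L]

/-- The closure of the image of `R` in `L`. -/
def closureRange (R : Type u) [CommRing R] [Algebra R K] (j : K →+* L) : Subring L :=
  (j.comp (algebraMap R K)).range.topologicalClosure

omit [TopologicalSpace K] [T3Space L] in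
lemma mem_closureRange (j : K →+* L) (r : R) : j (algebraMap R K r) ∈ closureRange R j :=
  Subring.le_topologicalClosure _ ⟨r, rfl⟩

/-- By `hfrac` the s^n R already form a basis at zero in K, and in a regular space the closures of
their images form a basis at zero in L. Multiplication by the unit s^n is a homeomorphism of L, so
it commutes with closure. -/
lemma hasBasis_powNhd (hK : (𝓝 (0 : K)).HasBasis (fun _ : Kˣ => True)
      fun a => (Carlitz.fracNhd R K a : Set K)) {j : K →+* L} (hj : IsDenseInducing j)
    {s : R} (hs : algebraMap R K s ≠ 0)
    (hfrac : ∀ x : K, ∃ (n : ℕ) (r : R), algebraMap R K s ^ n * x = algebraMap R K r) :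
    (𝓝 (0 : L)).HasBasis (fun _ => True)
      fun n => (powNhd (closureRange R j) (j (algebraMap R K s)) n : Set L) := by
  have h1 : (𝓝 (0 : K)).HasBasis (fun _ : ℕ => True)
      fun n => (Carlitz.fracNhd R K (Units.mk0 _ hs ^ n) : Set K) := by
    refine hK.to_hasBasis ?_ fun n _ => ⟨_, trivial, subset_rfl⟩
    intro a _
    obtain ⟨n, r, hr⟩ := hfrac (a⁻¹ : Kˣ)
    refine ⟨n, trivial, fun x hx => ?_⟩
    obtain ⟨y, rfl⟩ := Carlitz.mem_fracNhd.mp hx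
    refine Carlitz.mem_fracNhd.mpr ⟨r * y, ?_⟩
    rw [map_mul, ← hr]
    simp
    field_simp
  have h2 := h1.hasBasis_of_isDenseInducing hj
  rw [map_zero] at h2
  convert h2 using 2 with n
  let v : Lˣ := Units.map j.toMonoidHom (Units.mk0 _ hs ^ n)
  have hv : (v : L) = j (algebraMap R K s) ^ n := by simp [v]
  have e1 : (powNhd (closureRange R j) (j (algebraMap R K s)) n : Set L) =
      (fun x => (v : L) * x) '' closure (Set.range (j.comp (algebraMap R K))) := by
    ext x
    rw [SetLike.mem_coe, mem_powNhd, ← hv]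
    rfl
  rw [e1]
  change Homeomorph.smul v '' _ = _
  rw [(Homeomorph.smul v).image_closure]
  congr 1
  ext x
  simp only [Set.mem_image, Set.mem_range, SetLike.mem_coe, Carlitz.mem_fracNhd]
  constructor
  · rintro ⟨_, ⟨r, rfl⟩, rfl⟩
    exact ⟨_, ⟨r, rfl⟩, by simp [v, Units.smul_def]⟩
  · rintro ⟨_, ⟨r, rfl⟩, rfl⟩
    exact ⟨_, ⟨r, rfl⟩, by simp [v, Units.smul_def]⟩

end Completion

section Coefficients

variable {k : Type u} [Field k] [Fintype k] {R K : Type u} [CommRing R] [IsLocalRing R] [Field K]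
  [Algebra R K] [Algebra (Polynomial k) K]

/-- With t = 1/s the denominator of the recursion is s^(-q^(i+1)) (1 - s^(q^(i+1) - 1)), and the
second factor is a unit of R. So the exponents of s satisfy a₀ = 0 and a_(i+1) = q a_i + q^(i+1),
whence a_i = i q^i. -/
lemma exists_expCoeff_eq {s : R} (hs : s ∈ IsLocalRing.maximalIdeal R)
    (hst : algebraMap (Polynomial k) K Polynomial.X * algebraMap R K s = 1) (i : ℕ) :
    ∃ r : R, Carlitz.expCoeff k K i =
      algebraMap R K r * algebraMap R K s ^ (i * Fintype.card k ^ i) := by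
  set q := Fintype.card k with hq
  set t := algebraMap (Polynomial k) K Polynomial.X with ht
  have hq1 : 1 < q := Fintype.one_lt_card
  have hs0 : algebraMap R K s ≠ 0 := right_ne_zero_of_mul_eq_one hst
  induction i with
  | zero => exact ⟨1, by simp [Carlitz.expCoeff]⟩
  | succ i ih =>
    obtain ⟨r, hr⟩ := ih
    -- Writing q^(i+1) = Q + 2 avoids subtraction and shows that the exponent q^(i+1) - 1 = Q + 1 is
    -- positive.
    obtain ⟨Q, hQ⟩ : ∃ Q, q ^ (i + 1) = Q + 2 :=
      Nat.exists_eq_add_of_le' (hq1.trans_le (Nat.le_self_pow (Nat.succ_ne_zero i) q))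
    have hw : IsUnit (1 - s ^ (Q + 1)) := by
      refine (IsLocalRing.notMem_maximalIdeal).mp fun h => ?_
      have := Ideal.add_mem _ h (Ideal.pow_mem_of_mem _ hs (Q + 1) (Nat.succ_pos _))
      rw [sub_add_cancel] at this
      exact (Ideal.ne_top_iff_one _).mp (IsLocalRing.maximalIdeal.isMaximal R).ne_top this
    obtain ⟨w, hw⟩ := hw
    have hwinv : algebraMap R K (↑w⁻¹ : R) * (1 - algebraMap R K s ^ (Q + 1)) = 1 := by
      rw [← map_one (algebraMap R K), ← map_pow, ← map_sub, ← hw, ← map_mul, Units.inv_mul]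
    refine ⟨r ^ q * ↑w⁻¹, ?_⟩
    have hts : t = (algebraMap R K s)⁻¹ := eq_inv_of_mul_eq_one_left hst
    have hw0 : (1 - algebraMap R K s ^ (Q + 1)) ≠ 0 := right_ne_zero_of_mul_eq_one hwinv
    have hden : t ^ q ^ (i + 1) - t =
        (algebraMap R K s ^ (Q + 2))⁻¹ * (1 - algebraMap R K s ^ (Q + 1)) := by
      rw [hQ, hts, inv_pow, eq_inv_mul_iff_mul_eq₀ (pow_ne_zero _ hs0), mul_sub,
        mul_inv_cancel₀ (pow_ne_zero _ hs0), pow_succ _ (Q + 1), mul_inv_cancel_right₀ hs0]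
    have e : (i + 1) * q ^ (i + 1) = i * q ^ i * q + (Q + 2) := by
      rw [← hQ, pow_succ]
      ring
    rw [Carlitz.expCoeff, ← ht, ← hq, hden, hr, e, map_mul, eq_inv_of_mul_eq_one_left hwinv,
      map_pow]
    field_simp
    rw [mul_pow, ← pow_mul, mul_assoc, ← pow_add]

end Coefficients

/-! ### The exponential at a point above ∞. -/

section Completed

variable {k : Type u} [Field k] [Fintype k] {X : Scheme.{u}} [AlgebraicGeometry.IsIntegral X]
  (π : X ⟶ Carlitz.ProjSpace 1 k) [Surjective π] (z : X)

instance : CompleteSpace (Carlitz.Completed π z) :=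
  inferInstanceAs (CompleteSpace (UniformSpace.Completion (Carlitz.FieldAt π z)))

instance : IsUniformAddGroup (Carlitz.Completed π z) :=
  inferInstanceAs (IsUniformAddGroup (UniformSpace.Completion (Carlitz.FieldAt π z)))

instance : Algebra (X.presheaf.stalk z) (Carlitz.FieldAt π z) :=
  inferInstanceAs (Algebra (X.presheaf.stalk z) X.functionField)

/-- The inverse `s` of the coordinate `t` lies in the maximal ideal of `𝒪_{X,z}`, and
`K = 𝒪_{X,z}[1/s]`. -/
structure IsInvCoord (s : X.presheaf.stalk z) : Prop where
  mem : s ∈ IsLocalRing.maximalIdeal (X.presheaf.stalk z)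
  coord_mul : algebraMap (Polynomial k) (Carlitz.FieldAt π z) Polynomial.X *
    algebraMap (X.presheaf.stalk z) (Carlitz.FieldAt π z) s = 1
  exists_pow_mul (x : Carlitz.FieldAt π z) : ∃ (n : ℕ) (r : X.presheaf.stalk z),
    algebraMap (X.presheaf.stalk z) (Carlitz.FieldAt π z) s ^ n * x = algebraMap _ _ r

variable {π z} {s : X.presheaf.stalk z} (hs : IsInvCoord π z s)
include hs

omit [Fintype k] in
lemma IsInvCoord.hasBasis : (𝓝 (0 : Carlitz.Completed π z)).HasBasis (fun _ => True)
    fun n => (powNhd (closureRange (X.presheaf.stalk z) (Carlitz.toCompleted π z))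
      (Carlitz.toCompleted π z (algebraMap _ _ s)) n : Set (Carlitz.Completed π z)) := by
  refine hasBasis_powNhd ?_ UniformSpace.Completion.isDenseInducing_coe
    (right_ne_zero_of_mul_eq_one hs.coord_mul) hs.exists_pow_mul
  exact (Carlitz.fracBasis (X.presheaf.stalk z) X.functionField).hasBasis_nhds_zero

lemma IsInvCoord.exists_expTerm_eq : ∃ u : ℕ → Carlitz.Completed π z,
    (∀ i, u i ∈ closureRange (X.presheaf.stalk z) (Carlitz.toCompleted π z)) ∧ u 0 = 1 ∧
    ∀ γ, Carlitz.expTerm π z γ = fun i => u i * Carlitz.toCompleted π z (algebraMap _ _ s) ^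
      (i * Fintype.card k ^ i) * γ ^ Fintype.card k ^ i := by
  choose r hr using exists_expCoeff_eq (K := Carlitz.FieldAt π z) hs.mem hs.coord_mul
  refine ⟨fun i => Carlitz.toCompleted π z (algebraMap _ _ (r i)),
    fun i => mem_closureRange _ _, ?_, fun γ => ?_⟩
  · have := hr 0
    simp only [Carlitz.expCoeff, pow_zero, mul_one] at this
    simp [← this]
  · funext i
    simp [Carlitz.expTerm, hr]

lemma IsInvCoord.summable (γ : Carlitz.Completed π z) : Summable (Carlitz.expTerm π z γ) := by
  obtain ⟨u, hu, -, h⟩ := hs.exists_expTerm_eq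
  rw [h]
  exact summable_exp (mem_closureRange _ _) hs.hasBasis hu Fintype.card_pos γ

/-- K is dense and the closure of the local ring is open, so some f ∈ K has f - c in that closure,
which lies in the image of exp. In other words K_z = K + exp K_z. -/
lemma IsInvCoord.exists_sub_exp_eq (c : Carlitz.Completed π z) :
    ∃ (f : Carlitz.FieldAt π z) (γ : Carlitz.Completed π z),
      HasSum (Carlitz.expTerm π z γ) (Carlitz.toCompleted π z f - c) := by
  obtain ⟨u, hu, hu0, h⟩ := hs.exists_expTerm_eq
  simp only [h]
  have hopen := isOpen_of_basis hs.hasBasis 0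
  have hne : ((fun x => x - c) ⁻¹' (powNhd (closureRange (X.presheaf.stalk z)
      (Carlitz.toCompleted π z)) (Carlitz.toCompleted π z (algebraMap _ _ s)) 0 :
        Set (Carlitz.Completed π z))).Nonempty := ⟨c, by simp⟩
  obtain ⟨f, hf⟩ := (UniformSpace.Completion.denseRange_coe (α := Carlitz.FieldAt π z)).exists_mem_open
    (hopen.preimage (by fun_prop)) hne
  obtain ⟨y, hy, hf⟩ := mem_powNhd.mp hf
  rw [pow_zero, one_mul] at hf
  obtain ⟨γ, hγ⟩ := exists_hasSum_exp (mem_closureRange _ _) hs.hasBasis hu Fintype.card_pos hu0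
    (Carlitz.add_pow_card π z) hy
  refine ⟨f, γ, ?_⟩
  rw [hf] at hγ
  exact hγ

end Completed

end AdicExp

/-! ### Points of a smooth curve. -/

namespace CurveGeometry

section Algebra

/-- Étale algebras are quasi-finite, so comparable primes with the same contraction coincide.
Comparing P with the zero ideal shows that P contracts to a nonzero prime of the principal ideal
domain R[x]; this is maximal, hence also the contraction of M. -/
lemma prime_eq_of_le_of_etale {R B : Type*} [CommRing R] [CommRing B] [IsDomain B] (hR : IsField R)
    (g : MvPolynomial (Fin 1) R →+* B) (hg : g.Etale) {P M : Ideal B} [P.IsPrime] [M.IsPrime]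
    (hP : P ≠ ⊥) (hPM : P ≤ M) : P = M := by
  let _ := hR.toField
  have : IsPrincipalIdealRing (MvPolynomial (Fin 1) R) :=
    IsPrincipalIdealRing.of_surjective
      (MvPolynomial.uniqueAlgEquiv R (Fin 1)).symm.toRingEquiv.toRingHom
      (MvPolynomial.uniqueAlgEquiv R (Fin 1)).symm.surjective
  algebraize [g]
  have : Algebra.Etale (MvPolynomial (Fin 1) R) B := hg
  refine Algebra.QuasiFinite.eq_of_le_of_under_eq (R := MvPolynomial (Fin 1) R) P M hPM ?_
  have h0 : P.under (MvPolynomial (Fin 1) R) ≠ ⊥ := by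
    intro h
    refine hP (Algebra.QuasiFinite.eq_of_le_of_under_eq (R := MvPolynomial (Fin 1) R) ⊥ P bot_le ?_).symm
    rw [h]
    exact le_bot_iff.mp ((Ideal.comap_mono bot_le).trans h.le)
  have hmax : (P.under (MvPolynomial (Fin 1) R)).IsMaximal :=
    IsPrime.to_maximal_ideal h0
  exact hmax.eq_of_le (Ideal.IsPrime.ne_top inferInstance) (Ideal.comap_mono hPM)

end Algebra

section Dimension

variable {k : Type u} [Field k] {X : Scheme.{u}} (p : X ⟶ Spec (.of k))

lemma isField_sections {U : (Spec (.of k)).Opens} (hU : U ≠ ⊥) : IsField Γ(Spec (.of k), U) := by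
  have h : U = ⊤ := by
    rw [Ne, ← Opens.coe_eq_empty, ← Ne, ← Set.nonempty_iff_ne_empty] at hU
    obtain ⟨x, hx⟩ := hU
    refine top_le_iff.mp fun y _ => ?_
    rwa [Subsingleton.elim y x]
  subst h
  exact (Scheme.ΓSpecIso (.of k)).commRingCatIsoToRingEquiv.toMulEquiv.isField (Field.toIsField k)

lemma isLocallyNoetherian [LocallyOfFiniteType p] : IsLocallyNoetherian X := by
  refine isLocallyNoetherian_of_affine_cover (S := id) (iSup_affineOpens_eq_top X) fun V => ?_
  have h := p.finiteType_appLE (isAffineOpen_top _) V.2 le_top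
  have : IsNoetherianRing Γ(Spec (.of k), ⊤) :=
    IsLocallyNoetherian.component_noetherian ⟨⊤, isAffineOpen_top _⟩
  algebraize [(p.appLE ⊤ V.1 le_top).hom]
  exact Algebra.FiniteType.isNoetherianRing Γ(Spec (.of k), ⊤) Γ(X, V.1)

variable [AlgebraicGeometry.IsIntegral X]

/-- Every point is generic or closed. -/
lemma eq_of_specializes [SmoothOfRelativeDimension 1 p] {x y : X} (hxy : x ⤳ y)
    (hx : x ≠ genericPoint X) : x = y := by
  obtain ⟨U, hU, V, hV, hy, e, hf⟩ :=
    SmoothOfRelativeDimension.exists_isStandardSmoothOfRelativeDimension (n := 1) (f := p) y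
  -- Near y the curve is étale over an affine line over a field, and inside the affine V a
  -- specialization is an inclusion of primes.
  obtain ⟨g, -, hg⟩ := hf.exists_etale_mvPolynomial
  have hV' : Nonempty V := ⟨⟨y, hy⟩⟩
  have hxV : x ∈ V := hxy.mem_open V.isOpen hy
  have hlift : ∀ z ∈ V, ∃ a : PrimeSpectrum Γ(X, V), hV.fromSpec a = z := by
    intro z hz
    have : z ∈ Set.range hV.fromSpec := by rwa [hV.range_fromSpec]
    exact this
  obtain ⟨a, rfl⟩ := hlift x hxV
  obtain ⟨b, rfl⟩ := hlift y hy
  obtain ⟨c, hc⟩ := hlift (genericPoint X) (Carlitz.genericPoint_mem hy)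
  have hind := hV.fromSpec.isOpenEmbedding.isInducing
  have hab : a ≤ b := (PrimeSpectrum.le_iff_specializes a b).mpr (hind.specializes_iff.mp hxy)
  -- The zero ideal would specialize to the generic point, and so x would be generic.
  have ha : a.asIdeal ≠ ⊥ := by
    intro h
    apply hx
    have hac : a ≤ c := by
      change a.asIdeal ≤ c.asIdeal
      rw [h]
      exact bot_le
    have h1 := hind.specializes_iff.mpr ((PrimeSpectrum.le_iff_specializes a c).mp hac)
    rw [hc] at h1
    exact (h1.antisymm ((genericPoint_spec X).specializes trivial)).eq
  have := prime_eq_of_le_of_etale (isField_sections fun h => by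
    have := e hy
    rw [h] at this
    exact this) g hg ha hab
  rw [PrimeSpectrum.ext this]

lemma isClosed_singleton [SmoothOfRelativeDimension 1 p] {x : X} (hx : x ≠ genericPoint X) :
    IsClosed ({x} : Set X) := by
  rw [← closure_eq_iff_isClosed]
  refine Set.Subset.antisymm (fun y hy => ?_) subset_closure
  exact (eq_of_specializes p (specializes_iff_mem_closure.mpr hy) hx).symm

/-- Z is a finite union of closed irreducible sets. The generic point of each differs from that of
X, so it is closed, and the set is a single point. -/
lemma finite_of_isClosed [SmoothOfRelativeDimension 1 p] [NoetherianSpace X] {Z : Set X}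
    (hZ : IsClosed Z) (hg : genericPoint X ∉ Z) : Z.Finite := by
  obtain ⟨S, hS, hcl, hirr, h⟩ := NoetherianSpace.exists_finite_set_isClosed_irreducible hZ
  rw [h]
  refine Set.Finite.sUnion hS fun t ht => ?_
  have hgen := (hirr t ht).isGenericPoint_genericPoint (hcl t ht)
  have hne : (hirr t ht).genericPoint ≠ genericPoint X := by
    intro e
    apply hg
    rw [← e, h]
    exact ⟨t, ht, hgen.mem⟩
  rw [← hgen.def, (isClosed_singleton p hne).closure_eq]
  exact Set.finite_singleton _

end Dimension

/-! ### Finiteness of π and affineness of Y. -/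

section Proper

variable {k : Type u} [Field k]

/-- `Proj` is proper over the spectrum of the degree-zero part, the algebra being of finite type
over it; and the degree-zero part consists of the constants. -/
instance (n : ℕ) : IsProper (Carlitz.ProjSpace.toSpec n k) := by
  let S := MvPolynomial.homogeneousSubmodule (Fin (n + 1)) k 0
  have h0 : @IsScalarTower k S (MvPolynomial (Fin (n + 1)) k)
      Algebra.toSMul Algebra.toSMul Algebra.toSMul :=
    @IsScalarTower.of_algebraMap_eq k S (MvPolynomial (Fin (n + 1)) k) _ _ _ _ _ _ fun _ => rfl
  have h1 : Algebra.FiniteType S (MvPolynomial (Fin (n + 1)) k) :=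
    @Algebra.FiniteType.of_restrictScalars_finiteType k S (MvPolynomial (Fin (n + 1)) k)
      _ _ _ _ _ _ h0 _
  have h2 : Function.Surjective (algebraMap k S) := by
    rintro ⟨f, hf⟩
    have e := MvPolynomial.totalDegree_eq_zero_iff_eq_C.mp
      ((MvPolynomial.totalDegree_zero_iff_isHomogeneous (p := f)).mpr hf)
    exact ⟨_, Subtype.ext e.symm⟩
  have h3 : IsClosedImmersion (Spec.map (CommRingCat.ofHom
      (algebraMap k (MvPolynomial.homogeneousSubmodule (Fin (n + 1)) k 0)))) :=
    IsClosedImmersion.spec_of_surjective _ h2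
  have h4 : IsProper (Proj.toSpecZero (MvPolynomial.homogeneousSubmodule (Fin (n + 1)) k)) := by
    infer_instance
  exact MorphismProperty.comp_mem @IsProper _ _ h4 inferInstance

lemma isProper_of_isProjective {X : Scheme.{u}} {p : X ⟶ Spec (.of k)} (hp : Carlitz.IsProjective p) :
    IsProper p := by
  obtain ⟨n, i, hi, rfl⟩ := hp
  infer_instance

/-- The projective line has more than one point. -/
lemma exists_ne (y : Carlitz.ProjSpace 1 k) : ∃ x, x ≠ y := by
  let 𝒜 := MvPolynomial.homogeneousSubmodule (Fin 2) k
  have hpr : Prime (MvPolynomial.X 0 : MvPolynomial (Fin 2) k) := MvPolynomial.X_prime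
  have hirr : ∀ i, (MvPolynomial.X i : MvPolynomial (Fin 2) k) ∈ HomogeneousIdeal.irrelevant 𝒜 :=
    fun i => HomogeneousIdeal.mem_irrelevant_of_mem 𝒜 one_pos (Carlitz.X_mem k i)
  have hbot : (MvPolynomial.X 0 : MvPolynomial (Fin 2) k) ∉ (⊥ : HomogeneousIdeal 𝒜) := by
    intro h
    rw [← HomogeneousIdeal.mem_iff, HomogeneousIdeal.toIdeal_bot] at h
    exact hpr.ne_zero (Ideal.mem_bot.mp h)
  let a : ProjectiveSpectrum 𝒜 :=
    { asHomogeneousIdeal := ⊥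
      isPrime := by
        rw [HomogeneousIdeal.toIdeal_bot]
        infer_instance
      not_irrelevant_le := fun h => hbot (h (hirr 0)) }
  let b : ProjectiveSpectrum 𝒜 :=
    { asHomogeneousIdeal := ⟨Ideal.span {MvPolynomial.X 0}, Ideal.homogeneous_span 𝒜 _ (by
        rintro _ rfl
        exact ⟨1, Carlitz.X_mem k 0⟩)⟩
      isPrime := (Ideal.span_singleton_prime hpr.ne_zero).mpr hpr
      not_irrelevant_le := fun h => by
        have h1 := Ideal.mem_span_singleton.mp (h (hirr 1))
        simp [MvPolynomial.X_dvd_X] at h1 }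
  have hab : a ≠ b := by
    intro h
    have h1 : (MvPolynomial.X 0 : MvPolynomial (Fin 2) k) ∈ a.asHomogeneousIdeal := by
      rw [h]
      exact Ideal.mem_span_singleton_self _
    exact hbot h1
  by_cases h : a = y
  · exact ⟨b, fun hb => hab (h.trans hb.symm)⟩
  · exact ⟨a, h⟩

lemma isProper_toProjSpace {X : Scheme.{u}} {p : X ⟶ Spec (.of k)} [IsProper p]
    {π : X ⟶ Carlitz.ProjSpace 1 k} (hπ : π ≫ Carlitz.ProjSpace.toSpec 1 k = p) : IsProper π := by
  have : IsProper (π ≫ Carlitz.ProjSpace.toSpec 1 k) := by rwa [hπ]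
  exact IsProper.of_comp π (Carlitz.ProjSpace.toSpec 1 k)

lemma noetherianSpace {X : Scheme.{u}} (p : X ⟶ Spec (.of k)) [IsProper p] : NoetherianSpace X := by
  have := isLocallyNoetherian p
  have : CompactSpace X := QuasiCompact.compactSpace_of_compactSpace p
  have : IsNoetherian X := {}
  infer_instance

variable {X : Scheme.{u}} [AlgebraicGeometry.IsIntegral X] {p : X ⟶ Spec (.of k)}
  [SmoothOfRelativeDimension 1 p] [IsProper p]
  {π : X ⟶ Carlitz.ProjSpace 1 k} (hπ : π ≫ Carlitz.ProjSpace.toSpec 1 k = p) [Surjective π]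

include hπ

/-- The fibre of a closed y is closed and misses the generic point, as otherwise all of X would map
to y. If y is not closed, only the generic point can lie above it: the other points are closed and π
is a closed map. -/
lemma finite_fiber (y : Carlitz.ProjSpace 1 k) : (π ⁻¹' {y}).Finite := by
  have := noetherianSpace p
  have := isProper_toProjSpace hπ
  have hcl : ∀ x : X, x ≠ genericPoint X → IsClosed ({π x} : Set (Carlitz.ProjSpace 1 k)) := by
    intro x hx
    have := π.isClosedMap _ (isClosed_singleton p hx)
    rwa [Set.image_singleton] at this
  by_cases hy : IsClosed ({y} : Set (Carlitz.ProjSpace 1 k))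
  · refine finite_of_isClosed p (hy.preimage π.continuous) ?_
    intro hg
    obtain ⟨y', hy'⟩ := exists_ne y
    obtain ⟨x, rfl⟩ := π.surjective y'
    have h1 := ((genericPoint_spec X).specializes (Set.mem_univ x)).map π.continuous
    rw [Set.mem_preimage.mp hg] at h1
    exact hy' (h1.mem_closed hy rfl)
  · refine (Set.finite_singleton (genericPoint X)).subset fun x hx => ?_
    by_contra hne
    apply hy
    have := hcl x hne
    rwa [hx] at this

/-- A proper morphism with finite fibres is finite. Only its being affine is needed, to make Y
affine. -/
lemma isFinite_toProjSpace : IsFinite π := by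
  have := isProper_toProjSpace hπ
  have := LocallyQuasiFinite.of_finite_preimage_singleton (f := π) (finite_fiber hπ)
  exact IsFinite.of_isProper_of_locallyQuasiFinite π

lemma isAffineOpen_finitePart : IsAffineOpen (Carlitz.finitePart π) := by
  have : IsAffineHom π := (isFinite_toProjSpace hπ).toIsAffineHom
  have h : IsAffineOpen (Carlitz.affineLine k) :=
    Proj.isAffineOpen_basicOpen (MvPolynomial.homogeneousSubmodule (Fin 2) k)
      (f := MvPolynomial.X 0) (Carlitz.X_mem k 0) one_pos
  exact h.preimage π

end Proper

/-! ### The coordinate x₀ / x₁ at infinity. -/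

section InvCoord

variable (k : Type u) [Field k]

/-- The open set `D₊(x₁)`. -/
def affineLineAtInfty : (Carlitz.ProjSpace 1 k).Opens :=
  Proj.basicOpen (MvPolynomial.homogeneousSubmodule (Fin 2) k) (MvPolynomial.X 1)

/-- The element `x₀ / x₁`. -/
def invCoordAway : HomogeneousLocalization.Away (MvPolynomial.homogeneousSubmodule (Fin 2) k)
    (MvPolynomial.X (1 : Fin 2)) :=
  HomogeneousLocalization.Away.mk (MvPolynomial.homogeneousSubmodule (Fin 2) k)
    (d := 1) (Carlitz.X_mem k 1) 1 (MvPolynomial.X 0)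
    (by simpa only [one_smul] using Carlitz.X_mem k 0)

/-- The section `x₀ / x₁` of the structure sheaf. -/
def invCoord : Γ(Carlitz.ProjSpace 1 k, affineLineAtInfty k) :=
  (Proj.awayToSection (MvPolynomial.homogeneousSubmodule (Fin 2) k) (MvPolynomial.X 1)).hom
    (invCoordAway k)

lemma coord_eq : Carlitz.polyToSections k Polynomial.X =
    (Proj.awayToSection (MvPolynomial.homogeneousSubmodule (Fin 2) k) (MvPolynomial.X 0)).hom
      (Carlitz.coordAway k) := by
  change (Proj.awayToSection (MvPolynomial.homogeneousSubmodule (Fin 2) k) (MvPolynomial.X 0)).hom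
    (Polynomial.eval₂ _ (Carlitz.coordAway k) Polynomial.X) = _
  rw [Polynomial.eval₂_X]

variable {k}

lemma mem_affineLineAtInfty {y : Carlitz.ProjSpace 1 k} (hy : y ∉ Carlitz.affineLine k) :
    y ∈ affineLineAtInfty k := by
  have h := Proj.iSup_basicOpen_eq_top' (MvPolynomial.homogeneousSubmodule (Fin 2) k)
    (fun i : Fin 2 => MvPolynomial.X i) (fun i => ⟨1, Carlitz.X_mem k i⟩) (by
      rw [eq_top_iff]
      rintro f -
      induction f using MvPolynomial.induction_on with
      | C a =>
        let b : MvPolynomial.homogeneousSubmodule (Fin 2) k 0 := algebraMap k _ a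
        exact Subalgebra.algebraMap_mem _ b
      | add p q hp hq => exact add_mem hp hq
      | mul_X p i hp => exact mul_mem hp (Algebra.subset_adjoin ⟨i, rfl⟩))
  have hy' : y ∈ ⨆ i : Fin 2, Proj.basicOpen (MvPolynomial.homogeneousSubmodule (Fin 2) k)
      (MvPolynomial.X i) := by
    rw [h]
    trivial
  obtain ⟨i, hi⟩ := Opens.mem_iSup.mp hy'
  fin_cases i
  · exact absurd hi hy
  · exact hi

/-- In the stalk at y the section becomes the fraction x₀ / x₁, which is a unit only if x₀ is
outside the prime of y, that is, if y ∈ D₊(x₀). -/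
lemma notMem_basicOpen_invCoord {y : Carlitz.ProjSpace 1 k} (hy : y ∉ Carlitz.affineLine k) :
    y ∉ (Carlitz.ProjSpace 1 k).basicOpen (invCoord k) := by
  have hy1 := mem_affineLineAtInfty hy
  let 𝒜 := MvPolynomial.homogeneousSubmodule (Fin 2) k
  let x : ProjectiveSpectrum 𝒜 := y
  rw [Scheme.mem_basicOpen _ _ _ hy1]
  intro h
  have h1 : IsUnit (Proj.stalkIso' 𝒜 x
    ((Carlitz.ProjSpace 1 k).presheaf.germ (affineLineAtInfty k) y hy1 (invCoord k))) :=
    h.map (Proj.stalkIso' 𝒜 x)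
  have e : Proj.stalkIso' 𝒜 x
      ((Carlitz.ProjSpace 1 k).presheaf.germ (affineLineAtInfty k) y hy1 (invCoord k)) =
    HomogeneousLocalization.mapId 𝒜 (Submonoid.powers_le.mpr hy1) (invCoordAway k) :=
    Proj.stalkIso'_germ 𝒜 _ _ _ _
  rw [e, ← HomogeneousLocalization.isUnit_iff_isUnit_val] at h1
  have e2 : (HomogeneousLocalization.mapId 𝒜 (Submonoid.powers_le.mpr hy1) (invCoordAway k)).val =
      Localization.mk (MvPolynomial.X 0) ⟨MvPolynomial.X 1 ^ 1,
        Submonoid.pow_mem x.asHomogeneousIdeal.toIdeal.primeCompl hy1 1⟩ := rfl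
  rw [e2, Localization.mk_eq_mk', IsLocalization.AtPrime.isUnit_mk'_iff _
    x.asHomogeneousIdeal.toIdeal] at h1
  exact hy h1

lemma res_coord_mul_res_invCoord :
    (Carlitz.ProjSpace 1 k).presheaf.map
      (homOfLE (inf_le_left : Carlitz.affineLine k ⊓ affineLineAtInfty k ≤ _)).op
      (Carlitz.polyToSections k Polynomial.X) *
    (Carlitz.ProjSpace 1 k).presheaf.map
      (homOfLE (inf_le_right : Carlitz.affineLine k ⊓ affineLineAtInfty k ≤ _)).op
      (invCoord k) = 1 := by
  rw [coord_eq]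
  apply Subtype.ext
  funext x
  apply HomogeneousLocalization.val_injective
  let 𝒜 := MvPolynomial.homogeneousSubmodule (Fin 2) k
  let y : ProjectiveSpectrum 𝒜 := x.1
  have h0 : (MvPolynomial.X 0 : MvPolynomial (Fin 2) k) ∈ y.asHomogeneousIdeal.toIdeal.primeCompl :=
    x.2.1
  have h1 : (MvPolynomial.X 1 : MvPolynomial (Fin 2) k) ∈ y.asHomogeneousIdeal.toIdeal.primeCompl :=
    x.2.2
  change HomogeneousLocalization.val
    (HomogeneousLocalization.mapId 𝒜 (Submonoid.powers_le.mpr h0) (Carlitz.coordAway k) *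
      HomogeneousLocalization.mapId 𝒜 (Submonoid.powers_le.mpr h1) (invCoordAway k)) =
    HomogeneousLocalization.val (1 : HomogeneousLocalization.AtPrime 𝒜 y.asHomogeneousIdeal.toIdeal)
  rw [HomogeneousLocalization.val_mul, HomogeneousLocalization.val_one]
  change Localization.mk (MvPolynomial.X 1) ⟨MvPolynomial.X 0 ^ 1, Submonoid.pow_mem _ h0 1⟩ *
    Localization.mk (MvPolynomial.X 0) ⟨MvPolynomial.X 1 ^ 1, Submonoid.pow_mem _ h1 1⟩ = 1
  rw [Localization.mk_mul, ← Localization.mk_one, Localization.mk_eq_mk_iff, Localization.r_iff_exists]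
  refine ⟨1, ?_⟩
  simp only [OneMemClass.coe_one, Submonoid.coe_mul]
  ring

end InvCoord

/-! ### The local ring at a point above ∞. -/

section LocalRing

variable {k : Type u} [Field k] {X : Scheme.{u}} [AlgebraicGeometry.IsIntegral X]

/-- Primes of the stalk correspond to the points specializing to z, here only z and the generic
point; the latter belongs to the zero ideal. -/
lemma mem_prime_of_specializes {z : X} (hz : ∀ x : X, x ⤳ z → x ≠ genericPoint X → x = z)
    {P : Ideal (X.presheaf.stalk z)} [hP : P.IsPrime] (hne : P ≠ ⊥) :
    P = IsLocalRing.maximalIdeal (X.presheaf.stalk z) := by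
  let f : PrimeSpectrum (X.presheaf.stalk z) → X := X.fromSpecStalk z
  have hf : Topology.IsEmbedding f := (X.fromSpecStalk z).isEmbedding
  let a : PrimeSpectrum (X.presheaf.stalk z) := ⟨P, hP⟩
  have hc : f (IsLocalRing.closedPoint _) = z := Scheme.fromSpecStalk_closedPoint
  have h1 : f a ⤳ z := by
    have := (IsLocalRing.specializes_closedPoint a).map hf.continuous
    rwa [hc] at this
  have h2 : f a ≠ genericPoint X := by
    intro h
    have h3 : f a ⤳ f ⊥ := by
      rw [h]
      exact (genericPoint_spec X).specializes trivial
    have h4 : a ≤ ⊥ := (PrimeSpectrum.le_iff_specializes _ _).mpr (hf.specializes_iff.mp h3)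
    exact hne (le_bot_iff.mp h4)
  have h3 : a = IsLocalRing.closedPoint _ := hf.injective ((hz _ h1 h2).trans hc.symm)
  exact congrArg PrimeSpectrum.asIdeal h3

/-- For x = a / b every prime containing b is nonzero, hence maximal, and contains s. So s lies in
the radical of (b), and s^n = b c gives s^n x = a c. -/
lemma exists_pow_mul_eq {z : X} (hz : ∀ x : X, x ⤳ z → x ≠ genericPoint X → x = z)
    {s : X.presheaf.stalk z} (hs : s ∈ IsLocalRing.maximalIdeal (X.presheaf.stalk z))
    (x : X.functionField) : ∃ (n : ℕ) (r : X.presheaf.stalk z),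
      algebraMap (X.presheaf.stalk z) X.functionField s ^ n * x = algebraMap _ _ r := by
  obtain ⟨a, b, hb, rfl⟩ := IsFractionRing.div_surjective (A := X.presheaf.stalk z) x
  have hb0 : b ≠ 0 := nonZeroDivisors.ne_zero hb
  have hrad : s ∈ (Ideal.span {b}).radical := by
    rw [Ideal.radical_eq_sInf, Ideal.mem_sInf]
    rintro P ⟨hbP, hP⟩
    have hbP' : b ∈ P := hbP (Ideal.mem_span_singleton_self b)
    rw [mem_prime_of_specializes hz (P := P) (by rintro rfl; exact hb0 hbP')]
    exact hs
  obtain ⟨n, hn⟩ := hrad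
  obtain ⟨c, hc⟩ := Ideal.mem_span_singleton.mp hn
  refine ⟨n, a * c, ?_⟩
  have hb1 : algebraMap (X.presheaf.stalk z) X.functionField b ≠ 0 := by
    rwa [Ne, map_eq_zero_iff _ (IsFractionRing.injective (X.presheaf.stalk z) X.functionField)]
  rw [← map_pow, hc, map_mul, map_mul]
  field_simp

variable {π : X ⟶ Carlitz.ProjSpace 1 k} [Surjective π]

/-- The germ at z of the pullback of x₀ / x₁ works: it is not a unit since x₀ / x₁ is not one at π
z, and its product with t is 1 already on D₊(x₀) ∩ D₊(x₁). -/
lemma exists_isInvCoord {z : X} (hz : ∀ x : X, x ⤳ z → x ≠ genericPoint X → x = z)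
    (hzY : z ∉ Carlitz.finitePart π) : ∃ s, AdicExp.IsInvCoord π z s := by
  let V : X.Opens := π ⁻¹ᵁ affineLineAtInfty k
  have hzV : z ∈ V := mem_affineLineAtInfty hzY
  let σ : Γ(X, V) := π.app (affineLineAtInfty k) (invCoord k)
  have hs : X.presheaf.germ V z hzV σ ∈ IsLocalRing.maximalIdeal (X.presheaf.stalk z) := by
    rw [IsLocalRing.mem_maximalIdeal, mem_nonunits_iff, ← Scheme.mem_basicOpen]
    intro h
    exact notMem_basicOpen_invCoord hzY ((Scheme.preimage_basicOpen π (invCoord k)).ge h)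
  refine ⟨X.presheaf.germ V z hzV σ, hs, ?_, exists_pow_mul_eq hz hs⟩
  have hne : Nonempty V := ⟨⟨z, hzV⟩⟩
  change X.presheaf.germ (Carlitz.finitePart π) (genericPoint X) _
    (Carlitz.polyToSec π (Carlitz.finitePart π) le_rfl Polynomial.X) *
    algebraMap (X.presheaf.stalk z) X.functionField (X.presheaf.germ V z hzV σ) = 1
  rw [Scheme.algebraMap_germ_eq_germToFunctionField]
  have hg : genericPoint X ∈ Carlitz.finitePart π ⊓ V :=
    ⟨Carlitz.genericPoint_mem_finitePart π, Carlitz.genericPoint_mem hzV⟩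
  rw [← X.presheaf.germ_res_apply (homOfLE (inf_le_left : Carlitz.finitePart π ⊓ V ≤ _)) _ hg,
    Scheme.germToFunctionField,
    ← X.presheaf.germ_res_apply (homOfLE (inf_le_right : Carlitz.finitePart π ⊓ V ≤ _)) _ hg,
    ← map_mul]
  have e1 : Carlitz.polyToSec π (Carlitz.finitePart π) le_rfl Polynomial.X =
      π.app (Carlitz.affineLine k) (Carlitz.polyToSections k Polynomial.X) := by
    simp only [Carlitz.polyToSec, Carlitz.finitePart, Scheme.Hom.appLE_eq_app]
    rfl
  have e2 := congrArg (π.app (Carlitz.affineLine k ⊓ affineLineAtInfty k))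
    (res_coord_mul_res_invCoord (k := k))
  rw [map_mul, map_one] at e2
  have n1 := ConcreteCategory.congr_hom (π.naturality (homOfLE (inf_le_left :
    Carlitz.affineLine k ⊓ affineLineAtInfty k ≤ _)).op) (Carlitz.polyToSections k Polynomial.X)
  have n2 := ConcreteCategory.congr_hom (π.naturality (homOfLE (inf_le_right :
    Carlitz.affineLine k ⊓ affineLineAtInfty k ≤ _)).op) (invCoord k)
  rw [ConcreteCategory.comp_apply, ConcreteCategory.comp_apply] at n1 n2
  rw [n1, n2] at e2
  rw [e1]
  refine (congrArg _ e2).trans (map_one _)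

end LocalRing

section Topology

variable {k : Type u} [Field k] {X : Scheme.{u}} [AlgebraicGeometry.IsIntegral X]
  (p : X ⟶ Spec (.of k)) [SmoothOfRelativeDimension 1 p] [NoetherianSpace X]

include p in
/-- A nonempty open set becomes a neighbourhood of every point `z` on adding `z`. -/
lemma exists_nhd_subset {V : X.Opens} (hV : genericPoint X ∈ V) (z : X) :
    ∃ W : X.Opens, z ∈ W ∧ ∀ x ∈ W, x ∈ V ∨ x = z := by
  -- The complement of V is a finite set of closed points, so it stays closed when z is taken out.
  have hfin : ((V : Set X)ᶜ \ {z}).Finite :=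
    (finite_of_isClosed p V.isOpen.isClosed_compl fun h => h hV).subset Set.sdiff_subset
  have hcl : IsClosed ((V : Set X)ᶜ \ {z}) := by
    rw [← Set.biUnion_of_singleton ((V : Set X)ᶜ \ {z})]
    refine hfin.isClosed_biUnion fun x hx => isClosed_singleton p ?_
    rintro rfl
    exact hx.1 hV
  refine ⟨⟨_, hcl.isOpen_compl⟩, fun h => h.2 rfl, fun x hx => ?_⟩
  by_contra! h
  exact hx ⟨h.1, h.2⟩

end Topology

/-! ### Regular functions and the Cousin problem on an affine open set. -/

section Regular

variable {X : Scheme.{u}} [AlgebraicGeometry.IsIntegral X]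

/-- The rational function `φ` is regular on the nonempty open set `V`. -/
def IsRegularOn (V : X.Opens) (φ : X.functionField) : Prop :=
  ∃ (h : genericPoint X ∈ V) (s : Γ(X, V)), X.presheaf.germ V (genericPoint X) h s = φ

lemma IsRegularOn.mono {V W : X.Opens} {φ : X.functionField} (h : IsRegularOn V φ) (hW : W ≤ V)
    (hg : genericPoint X ∈ W) : IsRegularOn W φ := by
  obtain ⟨hV, s, rfl⟩ := h
  exact ⟨hg, X.presheaf.map (homOfLE hW).op s, X.presheaf.germ_res_apply (homOfLE hW) _ hg s⟩

lemma IsRegularOn.add {V : X.Opens} {φ ψ : X.functionField} (h : IsRegularOn V φ)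
    (h' : IsRegularOn V ψ) : IsRegularOn V (φ + ψ) := by
  obtain ⟨hV, s, rfl⟩ := h
  obtain ⟨_, s', rfl⟩ := h'
  exact ⟨hV, s + s', map_add _ _ _⟩

lemma IsRegularOn.mul {V : X.Opens} {φ ψ : X.functionField} (h : IsRegularOn V φ)
    (h' : IsRegularOn V ψ) : IsRegularOn V (φ * ψ) := by
  obtain ⟨hV, s, rfl⟩ := h
  obtain ⟨_, s', rfl⟩ := h'
  exact ⟨hV, s * s', map_mul _ _ _⟩

lemma IsRegularOn.sum {V : X.Opens} (hV : genericPoint X ∈ V) {ι : Type*} (t : Finset ι)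
    {φ : ι → X.functionField} (h : ∀ i ∈ t, IsRegularOn V (φ i)) :
    IsRegularOn V (∑ i ∈ t, φ i) :=
  Finset.sum_induction _ _ (fun _ _ => IsRegularOn.add) ⟨hV, 0, map_zero _⟩ h

lemma IsRegularOn.pow {V : X.Opens} {φ : X.functionField} (h : IsRegularOn V φ) (n : ℕ) :
    IsRegularOn V (φ ^ n) := by
  obtain ⟨hV, s, rfl⟩ := h
  exact ⟨hV, s ^ n, map_pow _ _ _⟩

lemma exists_isRegularOn (φ : X.functionField) : ∃ V : X.Opens, IsRegularOn V φ := by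
  obtain ⟨V, hV, s, hs⟩ := X.presheaf.exists_germ_eq φ
  exact ⟨V, hV, s, hs⟩

variable {Y : X.Opens} (hY : IsAffineOpen Y) (hg : genericPoint X ∈ Y)

-- D(b) is affine, and sections over D(b) ∩ D(c) are the localization at c of those over D(b), so a
-- power of c clears the denominator. Having all n ≥ N permits a common exponent for finitely many
-- functions.
include hY in
lemma exists_pow_mul_isRegularOn {b c : Γ(X, Y)} {φ : X.functionField}
    (h : IsRegularOn (X.basicOpen b ⊓ X.basicOpen c) φ) :
    ∃ N, ∀ n, N ≤ n →
      IsRegularOn (X.basicOpen b) (X.presheaf.germ Y (genericPoint X) hg c ^ n * φ) := by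
  obtain ⟨hV, s, rfl⟩ := h
  let c' : Γ(X, X.basicOpen b) := X.presheaf.map (homOfLE (X.basicOpen_le b)).op c
  have hc' : X.basicOpen c' = X.basicOpen b ⊓ X.basicOpen c := X.basicOpen_res c _
  have hloc := (hY.basicOpen b).isLocalization_basicOpen c'
  let s' : Γ(X, X.basicOpen c') := X.presheaf.map (homOfLE hc'.le).op s
  obtain ⟨⟨a, ⟨_, N, rfl⟩⟩, ha⟩ := IsLocalization.surj (Submonoid.powers c') s'
  have hV' : genericPoint X ∈ X.basicOpen c' := by rwa [hc']
  have hcg : X.presheaf.germ (X.basicOpen b) _ hV.1 c' = X.presheaf.germ Y _ hg c :=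
    X.presheaf.germ_res_apply (homOfLE (X.basicOpen_le b)) _ hV.1 c
  have hreg : IsRegularOn (X.basicOpen b) (X.presheaf.germ Y (genericPoint X) hg c) :=
    ⟨hV.1, c', hcg⟩
  have hN : IsRegularOn (X.basicOpen b) (X.presheaf.germ Y (genericPoint X) hg c ^ N *
      X.presheaf.germ _ (genericPoint X) hV s) := by
    refine ⟨hV.1, a, ?_⟩
    have e := congrArg (X.presheaf.germ (X.basicOpen c') (genericPoint X) hV') ha
    have e1 : ∀ y, X.presheaf.germ (X.basicOpen c') (genericPoint X) hV'
        (algebraMap Γ(X, X.basicOpen b) Γ(X, X.basicOpen c') y) =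
          X.presheaf.germ (X.basicOpen b) (genericPoint X) hV.1 y := fun y =>
      X.presheaf.germ_res_apply (homOfLE (X.basicOpen_le c')) _ hV' y
    have e2 : X.presheaf.germ (X.basicOpen c') (genericPoint X) hV' s' =
        X.presheaf.germ _ (genericPoint X) hV s :=
      X.presheaf.germ_res_apply (homOfLE hc'.le) _ hV' s
    rw [map_mul, e1, e1, e2, map_pow, hcg] at e
    rw [← e, mul_comm]
  refine ⟨N, fun n hn => ?_⟩
  obtain ⟨d, rfl⟩ := Nat.exists_eq_add_of_le' hn
  rw [pow_add, mul_assoc]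
  exact (hreg.pow d).mul hN

include hY hg in
/-- On an affine open set, the first Cousin problem is solvable. -/
lemma exists_sub_isRegularOn (U : X → X.Opens) (hU : ∀ x, x ∈ U x) (φ : X → X.functionField)
    (hφ : ∀ x ∈ Y, ∀ y ∈ Y, IsRegularOn (U x ⊓ U y ⊓ Y) (φ x - φ y)) :
    ∃ g : X.functionField, ∀ y ∈ Y, ∃ V : X.Opens, y ∈ V ∧ V ≤ U y ∧ IsRegularOn V (φ y - g) := by
  have h1 : ∀ y : Y, ∃ b : Γ(X, Y), X.basicOpen b ≤ U y.1 ⊓ Y ∧ y.1 ∈ X.basicOpen b := by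
    intro y
    obtain ⟨b, hb, hyb⟩ := hY.exists_basicOpen_le (V := U y.1 ⊓ Y) ⟨y.1, hU y.1, y.2⟩ y.2
    exact ⟨b, hb, hyb⟩
  choose b hbU hyb using h1
  have hspan : Ideal.span (Set.range b) = ⊤ := by
    rw [← hY.iSup_basicOpen_eq_self_iff]
    refine le_antisymm (iSup_le fun f => X.basicOpen_le _) fun y hy => ?_
    exact Opens.mem_iSup.mpr ⟨⟨b ⟨y, hy⟩, ⟨y, hy⟩, rfl⟩, hyb ⟨y, hy⟩⟩
  -- Finitely many of the sets D(b) cover Y; this makes the common exponent M possible.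
  obtain ⟨T, hT, hTspan⟩ := (Ideal.span_eq_top_iff_finite _).mp hspan
  choose pt hpt using fun r : T => hT r.2
  have hbg : ∀ y, genericPoint X ∈ X.basicOpen (b y) := fun y => Carlitz.genericPoint_mem (hyb y)
  let G := X.presheaf.germ Y (genericPoint X) hg
  have h2 : ∀ i j : T, ∃ N, ∀ n, N ≤ n → IsRegularOn (X.basicOpen (b (pt i)))
      (G (b (pt j)) ^ n * (φ (pt i) - φ (pt j))) := by
    intro i j
    refine exists_pow_mul_isRegularOn hY hg ((hφ _ (pt i).2 _ (pt j).2).mono ?_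
      ⟨hbg _, hbg _⟩)
    exact le_inf (inf_le_inf ((hbU _).trans inf_le_left) ((hbU _).trans inf_le_left))
      (inf_le_left.trans ((hbU _).trans inf_le_right))
  choose N hN using h2
  let M := Finset.univ.sup fun ij : T × T => N ij.1 ij.2
  have hM : ∀ i j, N i j ≤ M := fun i j =>
    Finset.le_sup (f := fun ij : T × T => N ij.1 ij.2) (Finset.mem_univ (i, j))
  have hspan' : Ideal.span (Set.range fun i : T => b (pt i) ^ M) = ⊤ := by
    have e : Set.range (fun i : T => b (pt i) ^ M) = (fun x => x ^ M) '' (T : Set Γ(X, Y)) := by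
      ext x
      simp [hpt]
    rw [e]
    exact Ideal.span_pow_eq_top _ hTspan M
  obtain ⟨c, hc⟩ := Ideal.mem_span_range_iff_exists_fun.mp
    ((Ideal.eq_top_iff_one _).mp hspan')
  have hc' : ∑ i : T, G (c i) * G (b (pt i)) ^ M = 1 := by
    have := congrArg G hc
    simpa using this
  -- The c_i b_i^M act as a partition of unity: φ_i - g = ∑ c_j b_j^M (φ_i - φ_j), and each summand
  -- is regular on D(b_i) by the choice of M.
  refine ⟨∑ i : T, G (c i) * G (b (pt i)) ^ M * φ (pt i), fun y hy => ?_⟩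
  have h3 : ∀ i : T, IsRegularOn (X.basicOpen (b (pt i)))
      (φ (pt i) - ∑ j : T, G (c j) * G (b (pt j)) ^ M * φ (pt j)) := by
    intro i
    have e : φ (pt i) - ∑ j : T, G (c j) * G (b (pt j)) ^ M * φ (pt j) =
        ∑ j : T, G (c j) * (G (b (pt j)) ^ M * (φ (pt i) - φ (pt j))) := by
      nth_rewrite 1 [← one_mul (φ (pt i)), ← hc', Finset.sum_mul]
      rw [← Finset.sum_sub_distrib]
      exact Finset.sum_congr rfl fun j _ => by ring
    rw [e]
    refine IsRegularOn.sum (hbg _) _ fun j _ => IsRegularOn.mul ?_ (hN i j M (hM i j))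
    exact IsRegularOn.mono ⟨hg, c j, rfl⟩ (X.basicOpen_le _) (hbg _)
  have hycov : y ∈ ⨆ f : (T : Set Γ(X, Y)), X.basicOpen f.1 := by
    rw [hY.iSup_basicOpen_eq_self_iff.mpr hTspan]
    exact hy
  obtain ⟨i, hi⟩ := Opens.mem_iSup.mp hycov
  have hi' : y ∈ X.basicOpen (b (pt i)) := by
    rw [hpt i]
    exact hi
  refine ⟨U y ⊓ X.basicOpen (b (pt i)), ⟨hU y, hi'⟩, inf_le_left, ?_⟩
  have hgen : genericPoint X ∈ U y ⊓ X.basicOpen (b (pt i)) :=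
    ⟨Carlitz.genericPoint_mem (hU y), hbg _⟩
  -- Compare φ_y with g through φ_i, where D(b_i) contains y.
  rw [← sub_add_sub_cancel _ (φ (pt i))]
  refine IsRegularOn.add ((hφ y hy _ (pt i).2).mono ?_ hgen) ((h3 i).mono inf_le_right hgen)
  exact le_inf (inf_le_inf_left _ ((hbU _).trans inf_le_left))
    (inf_le_right.trans (X.basicOpen_le _))

end Regular

end CurveGeometry

/-! ### The exact sequence of sheaves and its global sections. -/

namespace CarlitzSequence

open Carlitz

variable {k : Type u} [Field k] [Fintype k] {X : Scheme.{u}} [AlgebraicGeometry.IsIntegral X]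
  (π : X ⟶ ProjSpace 1 k) [Surjective π]

/-- The presheaf `U ↦ C₀(U ∩ Y) × ∏_{z ∈ U \ Y} K_z`. -/
def pairsPresheaf : TopCat.Presheaf (ModuleCat.{u} (Polynomial k)) X where
  obj U := ModuleCat.of (Polynomial k) (Pairs π U.unop)
  map {U V} f := ModuleCat.ofHom (Pairs.res π f.unop.le)
  map_id U := by
    refine ModuleCat.hom_ext (LinearMap.ext fun s => Prod.ext ?_ rfl)
    exact ConcreteCategory.congr_hom (X.presheaf.map_id _) s.1
  map_comp {U V W} f g := by
    refine ModuleCat.hom_ext (LinearMap.ext fun s => Prod.ext ?_ rfl)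
    exact ConcreteCategory.congr_hom (X.presheaf.map_comp
      (homOfLE (inf_le_inf_right (finitePart π) f.unop.le)).op
      (homOfLE (inf_le_inf_right (finitePart π) g.unop.le)).op) s.1

/-- The first component glues because 𝒪_X is a sheaf. The second is given point by point, so any
member of the covering that contains z determines its value at z. -/
lemma pairsPresheaf_isSheaf : (pairsPresheaf (k := k) π).IsSheaf := by
  rw [TopCat.Presheaf.isSheaf_iff_isSheafUniqueGluing]
  intro ι U s hc
  let V : ι → X.Opens := fun i => U i ⊓ finitePart π
  have hle : ∀ i, V i ≤ iSup U ⊓ finitePart π := fun i => inf_le_inf_right _ (le_iSup U i)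
  have hcov : iSup U ⊓ finitePart π ≤ iSup V := by rw [iSup_inf_eq]
  let c : ∀ i, Γ(X, V i) := fun i => (s i).1
  have hcc : ∀ i j, X.presheaf.map (homOfLE (inf_le_left : V i ⊓ V j ≤ V i)).op (c i) =
      X.presheaf.map (homOfLE (inf_le_right : V i ⊓ V j ≤ V j)).op (c j) := by
    intro i j
    have h1 : X.presheaf.map (homOfLE (inf_le_inf_right (finitePart π)
          (inf_le_left : U i ⊓ U j ≤ U i))).op (c i) =
        X.presheaf.map (homOfLE (inf_le_inf_right (finitePart π)
          (inf_le_right : U i ⊓ U j ≤ U j))).op (c j) := congrArg Prod.fst (hc i j)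
    have hW : V i ⊓ V j ≤ (U i ⊓ U j) ⊓ finitePart π :=
      le_inf (inf_le_inf inf_le_left inf_le_left) (inf_le_left.trans inf_le_right)
    have h2 := congrArg (X.presheaf.map (homOfLE hW).op) h1
    rw [← ConcreteCategory.comp_apply, ← ConcreteCategory.comp_apply, ← Functor.map_comp,
      ← Functor.map_comp] at h2
    exact h2
  obtain ⟨c₀, hc₀, huniq⟩ := X.sheaf.existsUnique_gluing' V (iSup U ⊓ finitePart π)
    (fun i => homOfLE (hle i)) hcov c hcc
  choose idx hidx using fun z : InftyIn π (iSup U) => Opens.mem_iSup.mp z.2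
  let γ : ∀ z : InftyIn π (iSup U), Completed π z.1.1 := fun z => (s (idx z)).2 ⟨z.1, hidx z⟩
  have hγ : ∀ (z : InftyIn π (iSup U)) (i : ι) (hz : z.1.1 ∈ U i),
      γ z = (s i).2 ⟨z.1, hz⟩ := fun z i hz =>
    congrFun (congrArg Prod.snd (hc (idx z) i)) ⟨z.1, hidx z, hz⟩
  refine ⟨(c₀, γ), fun i => Prod.ext (hc₀ i) (funext fun z => ?_), ?_⟩
  · exact hγ ⟨z.1, le_iSup U i z.2⟩ i z.2
  · intro τ h
    refine Prod.ext (huniq τ.1 fun i => congrArg Prod.fst (h i)) (funext fun z => ?_)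
    exact congrFun (congrArg Prod.snd (h (idx z))) ⟨z.1, hidx z⟩

/-- The sheaf `U ↦ C₀(U ∩ Y) × ∏_{z ∈ U \ Y} K_z`. -/
def pairsSheaf : SheafCohomology.ModSheaf (Polynomial k) (X : TopCat) :=
  ⟨pairsPresheaf π, pairsPresheaf_isSheaf π⟩

/-- The presheaf `U ↦ ∏_{z ∈ U \ Y} C₀(K_z)`. -/
def inftyPresheaf : TopCat.Presheaf (ModuleCat.{u} (Polynomial k)) X where
  obj U := ModuleCat.of (Polynomial k) (∀ z : InftyIn π U.unop, C0 k (Completed π z.1.1))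
  map {U V} f := ModuleCat.ofHom
    { toFun := fun c z => c ⟨z.1, f.unop.le z.2⟩
      map_add' := fun _ _ => rfl
      map_smul' := fun _ _ => rfl }

lemma inftyPresheaf_isSheaf : (inftyPresheaf (k := k) π).IsSheaf := by
  rw [TopCat.Presheaf.isSheaf_iff_isSheafUniqueGluing]
  intro ι U s hc
  choose idx hidx using fun z : InftyIn π (iSup U) => Opens.mem_iSup.mp z.2
  refine ⟨fun z => s (idx z) ⟨z.1, hidx z⟩, fun i => funext fun z => ?_, fun τ h => funext fun z => ?_⟩
  · exact congrFun (hc (idx ⟨z.1, le_iSup U i z.2⟩) i) ⟨z.1, hidx _, z.2⟩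
  · exact congrFun (h (idx z)) ⟨z.1, hidx z⟩

/-- The sheaf `U ↦ ∏_{z ∈ U \ Y} C₀(K_z)`. -/
def inftySheaf : SheafCohomology.ModSheaf (Polynomial k) (X : TopCat) :=
  ⟨inftyPresheaf π, inftyPresheaf_isSheaf π⟩

section Exp

variable {π} {z : X} (hz : ∀ γ, Summable (expTerm π z γ))
include hz

/-- Convergence turns the relation `IsExp` that defines C into an equation, and lets its linearity
pass to `exp`. -/
lemma isExp_iff (γ : Completed π z) (c : C0 k (Completed π z)) : IsExp π z γ c ↔ exp π z γ = c := by
  constructor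
  · intro h
    exact congrArg (toC0 k (Completed π z)) (HasSum.tsum_eq (f := expTerm π z γ) h)
  · rintro rfl
    exact (hz γ).hasSum

/-- The exponential as a linear map. -/
def expLinear : Completed π z →ₗ[Polynomial k] C0 k (Completed π z) where
  toFun := exp π z
  map_add' _ _ := (isExp_iff hz _ _).mp
    (((isExp_iff hz _ _).mpr rfl).add ((isExp_iff hz _ _).mpr rfl))
  map_smul' a _ := (isExp_iff hz _ _).mp (((isExp_iff hz _ _).mpr rfl).smul a)

end Exp

variable {π} (H : ∀ (z : AtInfty π) (γ : Completed π z.1), Summable (expTerm π z.1 γ))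

/-- The map `(c, γ) ↦ (c - exp γ_z)_z` on sections over `U`. -/
def diffOn (U : X.Opens) :
    Pairs π U →ₗ[Polynomial k] ∀ z : InftyIn π U, C0 k (Completed π z.1.1) :=
  LinearMap.pi fun z => (localize π z).comp (LinearMap.fst _ _ _) -
    (expLinear (H z.1)).comp ((LinearMap.proj z).comp (LinearMap.snd _ _ _))

lemma diffOn_apply (U : X.Opens) (s : Pairs π U) (z : InftyIn π U) :
    diffOn H U s z = localize π z s.1 - exp π z.1.1 (s.2 z) := rfl

lemma diffOn_eq_zero_iff (U : X.Opens) (s : Pairs π U) :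
    diffOn H U s = 0 ↔ s ∈ carlitzSections π U := by
  rw [funext_iff]
  refine forall_congr' fun z => ?_
  rw [diffOn_apply, isExp_iff (H z.1), Pi.zero_apply, sub_eq_zero, eq_comm]

variable (π) in
/-- The inclusion of `C` into the sheaf of pairs. -/
def incl : carlitzSheaf (k := k) π ⟶ pairsSheaf π :=
  ⟨{ app := fun U => ModuleCat.ofHom (carlitzSections π U.unop).subtype
     naturality := fun _ _ _ => rfl }⟩

/-- The morphism of sheaves `(c, γ) ↦ (c - exp γ_z)_z`. -/
def diff : pairsSheaf (k := k) π ⟶ inftySheaf π :=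
  ⟨{ app := fun U => ModuleCat.ofHom (diffOn H U.unop)
     naturality := fun U V f => by
      refine ModuleCat.hom_ext (LinearMap.ext fun s => funext fun z => ?_)
      exact congrArg (fun c => c - exp π z.1.1 (s.2 ⟨z.1, f.unop.le z.2⟩))
        (localize_res π f.unop.le s z) }⟩

/-- The sequence `0 → C → C₀(U ∩ Y) × ∏ K_z → ∏ C₀(K_z) → 0` of sheaves. -/
def sheafSequence : ShortComplex (SheafCohomology.ModSheaf (Polynomial k) (X : TopCat)) :=
  ShortComplex.mk (incl π) (diff H) (by
    apply ObjectProperty.hom_ext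
    refine NatTrans.ext (funext fun U => ModuleCat.hom_ext (LinearMap.ext fun s => ?_))
    exact (diffOn_eq_zero_iff H U.unop s.1).mpr s.2)

instance : Mono (incl (k := k) π) := by
  have h : Mono ((sheafToPresheaf _ _).map (incl (k := k) π)) := by
    rw [NatTrans.mono_iff_mono_app]
    exact fun U => (ModuleCat.mono_iff_injective _).mpr Subtype.val_injective
  exact (sheafToPresheaf _ _).mono_of_mono_map h

/-- A morphism killed by `diff` takes values in `carlitzSections`, so the inclusion is a kernel. -/
lemma sheafSequence_exact : (sheafSequence H).Exact := by
  have : Mono (sheafSequence H).f := inferInstanceAs (Mono (incl π))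
  refine ShortComplex.exact_of_f_is_kernel _
    (Limits.KernelFork.IsLimit.ofι' _ (sheafSequence H).zero fun {W} g hg => ?_)
  have hg' : ∀ U t, g.hom.app U t ∈ carlitzSections π U.unop := fun U t =>
    (diffOn_eq_zero_iff H U.unop _).mp
      (congrArg (fun φ : W ⟶ inftySheaf π => φ.hom.app U t) hg)
  exact ⟨⟨{ app := fun U => ModuleCat.ofHom ((g.hom.app U).hom.codRestrict _ (hg' U))
            naturality := fun U V f => by
              refine ModuleCat.hom_ext (LinearMap.ext fun s => Subtype.ext ?_)
              exact ConcreteCategory.congr_hom (g.hom.naturality f) s }⟩, rfl⟩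

/-- Take f ∈ K and γ with exp γ = f - q_x, and a neighbourhood of x whose other points all lie in Y
and in the domain of f. There f is a section of C₀, x is the only point above ∞, and f - exp γ =
q_x. -/
lemma exists_diffOn_eq (hY : ∀ (V : X.Opens), genericPoint X ∈ V → ∀ z : X,
      ∃ W : X.Opens, z ∈ W ∧ ∀ x ∈ W, x ∈ V ∨ x = z)
    (hexp : ∀ (z : AtInfty π) (c : Completed π z.1),
      ∃ (f : FieldAt π z.1) (γ : Completed π z.1),
        HasSum (expTerm π z.1 γ) (toCompleted π z.1 f - c))
    (U : X.Opens) (q : ∀ z : InftyIn π U, C0 k (Completed π z.1.1)) (x : InftyIn π U) :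
    ∃ (V : X.Opens) (hV : V ≤ U) (_ : x.1.1 ∈ V) (σ : Pairs π V),
      ∀ z : InftyIn π V, diffOn H V σ z = q ⟨z.1, hV z.2⟩ := by
  choose f γ hfγ using fun z : InftyIn π U =>
    hexp z.1 ((toC0 k (Completed π z.1.1)).symm (q z))
  obtain ⟨W, hW, s, hs⟩ := CurveGeometry.exists_isRegularOn (X := X) (f x)
  obtain ⟨V, hxV, hV⟩ := hY (W ⊓ finitePart π) ⟨hW, genericPoint_mem_finitePart π⟩ x.1.1
  have hVW : (V ⊓ U) ⊓ finitePart π ≤ W := by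
    intro y hy
    rcases hV y hy.1.1 with h | rfl
    · exact h.1
    · exact absurd hy.2 x.1.2
  have hg : genericPoint X ∈ (V ⊓ U) ⊓ finitePart π :=
    ⟨genericPoint_mem (U := V ⊓ U) (z := x.1.1) ⟨hxV, x.2⟩, genericPoint_mem_finitePart π⟩
  let c : Γ(X, (V ⊓ U) ⊓ finitePart π) := X.presheaf.map (homOfLE hVW).op s
  have hc : X.presheaf.germ _ (genericPoint X) hg c = f x :=
    (X.presheaf.germ_res_apply (homOfLE hVW) _ hg s).trans hs
  let σ : Pairs π (V ⊓ U) := (c, fun z => γ ⟨z.1, z.2.2⟩)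
  have key : diffOn H (V ⊓ U) σ ⟨x.1, hxV, x.2⟩ = q x := by
    have h1 : exp π x.1.1 (γ x) = toC0 k _ (toCompleted π x.1.1 (f x)) - q x :=
      (isExp_iff (H x.1) _ _).mp (hfγ x)
    have h2 : localize π (U := V ⊓ U) ⟨x.1, hxV, x.2⟩ c =
        toC0 k _ (toCompleted π x.1.1 (f x)) :=
      congrArg (toCompleted π x.1.1) hc
    refine (diffOn_apply H _ _ _).trans ?_
    exact (congrArg₂ (· - ·) h2 h1).trans (sub_sub_cancel _ _)
  refine ⟨V ⊓ U, inf_le_right, ⟨hxV, x.2⟩, σ, fun z => ?_⟩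
  have hz : z = ⟨x.1, hxV, x.2⟩ := by
    refine Subtype.ext (Subtype.ext ?_)
    rcases hV z.1.1 z.2.1 with h | h
    · exact absurd h.2 z.1.2
    · exact h
  clear_value σ
  subst hz
  exact key

lemma epi_diff (hY : ∀ (V : X.Opens), genericPoint X ∈ V → ∀ z : X,
      ∃ W : X.Opens, z ∈ W ∧ ∀ x ∈ W, x ∈ V ∨ x = z)
    (hexp : ∀ (z : AtInfty π) (c : Completed π z.1),
      ∃ (f : FieldAt π z.1) (γ : Completed π z.1),
        HasSum (expTerm π z.1 γ) (toCompleted π z.1 f - c)) :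
    Epi (diff H) := by
  refine (TopCat.Sheaf.isLocallySurjective_iff_epi (diff H)).mp ?_
  rw [TopCat.Presheaf.isLocallySurjective_iff]
  intro U q x hx
  by_cases hxY : x ∈ finitePart π
  -- No point of U ∩ Y lies above ∞, so the target is zero there.
  · refine ⟨U ⊓ finitePart π, inf_le_left, ⟨(0 : Pairs π (U ⊓ finitePart π)), ?_⟩, hx, hxY⟩
    exact funext fun z : InftyIn π (U ⊓ finitePart π) => absurd z.2.2 z.1.2
  · obtain ⟨V, hV, hxV, σ, hσ⟩ := exists_diffOn_eq H hY hexp U q ⟨⟨x, hxY⟩, hx⟩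
    exact ⟨V, hV, ⟨σ, funext hσ⟩, hxV⟩

omit [Fintype k] [Surjective π] in
/-- Evaluation of the germ at the generic point is injective on sections over `V ∩ Y`. -/
lemma germ_inf_injective {V : X.Opens} (hV : genericPoint X ∈ V ⊓ finitePart π) :
    Function.Injective (X.presheaf.germ (V ⊓ finitePart π) (genericPoint X) hV) :=
  germ_injective_of_isIntegral (X := X) _ _

/-- Germs at the generic point turn the C₀-component into a cocycle α of rational functions. It is a
difference of functions φ_x, and the Cousin problem on Y provides one g making every φ_x - g regular
near x on Y. -/
lemma pairsSheaf_cechAcyclic (hY : ∀ (V : X.Opens), genericPoint X ∈ V → ∀ z : X,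
      ∃ W : X.Opens, z ∈ W ∧ ∀ x ∈ W, x ∈ V ∨ x = z)
    (haff : IsAffineOpen (finitePart π)) :
    SheafCohomology.CechAcyclic (pairsSheaf (k := k) π) := by
  intro U hU f hf
  have hgU : ∀ x, genericPoint X ∈ U x := fun x => genericPoint_mem (hU x)
  have hgY := genericPoint_mem_finitePart π
  have hgα : ∀ x y, genericPoint X ∈ (U x ⊓ U y) ⊓ finitePart π := fun x y =>
    ⟨⟨hgU x, hgU y⟩, hgY⟩
  let a : ∀ x y, Γ(X, (U x ⊓ U y) ⊓ finitePart π) := fun x y => (f x y).1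
  let α : X → X → X.functionField := fun x y =>
    X.presheaf.germ _ (genericPoint X) (hgα x y) (a x y)
  have hα : ∀ x y z, α x y + α y z = α x z := by
    intro x y z
    let W : X.Opens := U x ⊓ U y ⊓ U z
    have hgW : genericPoint X ∈ W ⊓ finitePart π := ⟨⟨⟨hgU x, hgU y⟩, hgU z⟩, hgY⟩
    have h := congrArg Prod.fst (hf x y z W inf_le_left
      (le_inf (inf_le_left.trans inf_le_right) inf_le_right)
      (le_inf (inf_le_left.trans inf_le_left) inf_le_right))
    have h' := congrArg (X.presheaf.germ (W ⊓ finitePart π) (genericPoint X) hgW) h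
    refine Eq.trans ?_ (h'.trans ?_)
    · refine Eq.trans ?_ (map_add _ _ _).symm
      exact congrArg₂ (· + ·) (X.presheaf.germ_res_apply _ _ _ _).symm
        (X.presheaf.germ_res_apply _ _ _ _).symm
    · exact X.presheaf.germ_res_apply _ _ _ _
  -- The covering is indexed by points, so the generic point can serve as base index to split α over
  -- K.
  let φ : X → X.functionField := fun x => α x (genericPoint X)
  have hφ : ∀ x y, φ x - φ y = α x y := fun x y => by
    simp only [φ]
    rw [sub_eq_iff_eq_add, hα]
  obtain ⟨g, hg⟩ := CurveGeometry.exists_sub_isRegularOn haff hgY U hU φ (fun x _ y _ => by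
    rw [hφ]
    exact ⟨⟨⟨hgU x, hgU y⟩, hgY⟩, a x y, rfl⟩)
  have hV : ∀ x : X, ∃ V : X.Opens, x ∈ V ∧ V ≤ U x ∧
      CurveGeometry.IsRegularOn (V ⊓ finitePart π) (φ x - g) := by
    intro x
    by_cases hx : x ∈ finitePart π
    · obtain ⟨V, hxV, hVU, hreg⟩ := hg x hx
      exact ⟨V, hxV, hVU, hreg.mono inf_le_left ⟨genericPoint_mem hxV, hgY⟩⟩
    -- For x above ∞ regularity is needed only on a punctured neighbourhood, where it holds for
    -- every rational function.
    · obtain ⟨W, hreg⟩ := CurveGeometry.exists_isRegularOn (φ x - g)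
      obtain ⟨V, hxV, hV⟩ := hY (W ⊓ finitePart π) ⟨hreg.1, hgY⟩ x
      refine ⟨V ⊓ U x, ⟨hxV, hU x⟩, inf_le_right,
        hreg.mono ?_ ⟨⟨genericPoint_mem hxV, hgU x⟩, hgY⟩⟩
      intro y hy
      rcases hV y hy.1.1 with h | rfl
      · exact h.1
      · exact absurd hy.2 hx
  choose V hxV hVU hgV s hs using hV
  -- At z the component is that of f_(x,z), with z itself as base index; it exists because z ∈ U_z.
  let γ : ∀ x, Pairs π (V x) := fun x =>
    (s x, fun z => (f x z.1.1).2 ⟨z.1, hVU x z.2, hU z.1.1⟩)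
  refine ⟨V, hVU, hxV, γ, fun x y => ?_⟩
  refine Prod.ext ?_ (funext fun z : InftyIn π (V x ⊓ V y) => ?_)
  · have hgen : genericPoint X ∈ V x ⊓ V y := ⟨genericPoint_mem (hxV x), genericPoint_mem (hxV y)⟩
    have hgm : genericPoint X ∈ (V x ⊓ V y) ⊓ finitePart π := ⟨hgen, hgY⟩
    apply germ_inf_injective (π := π) hgm
    have e1 : X.presheaf.germ ((V x ⊓ V y) ⊓ finitePart π) (genericPoint X) hgm
        (X.presheaf.map (homOfLE (inf_le_inf_right (finitePart π)
          (inf_le_inf (hVU x) (hVU y)))).op (a x y)) = α x y :=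
      X.presheaf.germ_res_apply _ _ _ _
    have e2 : X.presheaf.germ ((V x ⊓ V y) ⊓ finitePart π) (genericPoint X) hgm
        (X.presheaf.map (homOfLE (inf_le_inf_right (finitePart π) inf_le_left)).op (s x) -
          X.presheaf.map (homOfLE (inf_le_inf_right (finitePart π) inf_le_right)).op (s y)) =
        (φ x - g) - (φ y - g) :=
      (map_sub _ _ _).trans (congrArg₂ (· - ·)
        ((X.presheaf.germ_res_apply _ _ _ _).trans (hs x))
        ((X.presheaf.germ_res_apply _ _ _ _).trans (hs y)))
    rw [sub_sub_sub_cancel_right, hφ] at e2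
    exact e1.trans e2.symm
  -- The cocycle identity for x, y, z read at z: f_(x,y) = f_(x,z) - f_(y,z).
  · have h := hf x y z.1.1 (U x ⊓ U y ⊓ U z.1.1) inf_le_left
      (le_inf (inf_le_left.trans inf_le_right) inf_le_right)
      (le_inf (inf_le_left.trans inf_le_left) inf_le_right)
    have h' := congrFun (congrArg Prod.snd h)
      ⟨z.1, ⟨hVU x z.2.1, hVU y z.2.2⟩, hU z.1.1⟩
    exact eq_sub_of_add_eq h'

/-- The family of all `C₀(K_z)` as the sections over `X` of the sheaf `U ↦ ∏_{z ∈ U \ Y} C₀(K_z)`. -/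
def toInftyTop : (∀ z : AtInfty π, C0 k (Completed π z.1)) →ₗ[Polynomial k]
    (inftySheaf (k := k) π).obj.obj (op ⊤) where
  toFun q := fun z : InftyIn π ⊤ => q z.1
  map_add' _ _ := rfl
  map_smul' _ _ := rfl

lemma toInftyTop_injective : Function.Injective (toInftyTop (π := π)) := fun _ _ h =>
  funext fun z => congrFun h (⟨z, trivial⟩ : InftyIn π ⊤)

lemma toInftyTop_surjective : Function.Surjective (toInftyTop (π := π)) := fun q =>
  ⟨fun z => q (⟨z, trivial⟩ : InftyIn π ⊤), rfl⟩

variable (π) in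
/-- The identification of the sections over `X` of the sheaf of pairs. -/
def pairsTop (s : Pairs (k := k) π ⊤) : C0Y (k := k) π × ∀ z : AtInfty π, Completed π z.1 :=
  (C0.map k (Sec.res π inf_le_right le_rfl (le_inf le_top le_rfl)) s.1, fun z => s.2 ⟨z, trivial⟩)

omit [Fintype k] [AlgebraicGeometry.IsIntegral X] [Surjective π] in
lemma res_res_self {U V : X.Opens} (hU : U ≤ finitePart π) (hV : V ≤ finitePart π)
    (h : V ≤ U) (h' : U ≤ V) (c : Sec π U hU) : Sec.res π hV hU h' (Sec.res π hU hV h c) = c := by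
  have e : X.presheaf.map (homOfLE h).op ≫ X.presheaf.map (homOfLE h').op = 𝟙 _ := by
    rw [← Functor.map_comp]
    exact X.presheaf.map_id _
  exact ConcreteCategory.congr_hom e c

omit [Fintype k] [AlgebraicGeometry.IsIntegral X] [Surjective π] in
variable (π) in
lemma res_bijective : Function.Bijective
    (Sec.res π inf_le_right le_rfl (le_inf le_top le_rfl) :
      Sec π (⊤ ⊓ finitePart π) inf_le_right → Sec π (finitePart π) le_rfl) :=
  Function.bijective_iff_has_inverse.mpr ⟨Sec.res π le_rfl inf_le_right inf_le_right,
    res_res_self _ _ _ _, res_res_self _ _ _ _⟩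

omit [Surjective π] in
variable (π) in
lemma pairsTop_bijective : Function.Bijective (pairsTop (k := k) π) := by
  constructor
  · intro s s' h
    refine Prod.ext ?_ (funext fun z => congrFun (congrArg Prod.snd h) z.1)
    exact (res_bijective π).1 (congrArg Prod.fst h)
  · rintro ⟨c, γ⟩
    obtain ⟨c', hc'⟩ := (res_bijective π).2 c
    exact ⟨(c', fun z => γ z.1), Prod.ext hc' rfl⟩

/-- The map `(c, γ) ↦ (c - exp γ_z)_z` on global sections. -/
def globalDiff : (C0Y (k := k) π × ∀ z : AtInfty π, Completed π z.1) →ₗ[Polynomial k]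
    ∀ z : AtInfty π, C0 k (Completed π z.1) :=
  LinearMap.pi fun z => (localizeY π z.1).comp (LinearMap.fst _ _ _) -
    (expLinear (H z)).comp ((LinearMap.proj z).comp (LinearMap.snd _ _ _))

/-- Sections over X involve X ∩ Y and the points above ∞ that lie in X, whereas δ is stated with Y
and all points above ∞. This square carries exactness from the one form to the other. -/
lemma toInftyTop_globalDiff_pairsTop (s : Pairs (k := k) π ⊤) :
    toInftyTop (globalDiff H (pairsTop π s)) = diffOn H ⊤ s := by
  refine funext fun z : InftyIn π ⊤ => ?_
  exact congrArg (fun c => toC0 k (Completed π z.1.1) c - exp π z.1.1 (s.2 z))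
    (Sec.toCompleted_res π z.1.1 inf_le_right le_rfl (le_inf le_top le_rfl)
      (genericPoint_mem_finitePart π) s.1)

variable (π) in
lemma globalInclusion_injective : Function.Injective (globalInclusion (k := k) π) := fun _ _ h =>
  Subtype.ext ((pairsTop_bijective π).1 h)

lemma exact_globalInclusion_globalDiff :
    Function.Exact (globalInclusion (k := k) π) (globalDiff H) := by
  intro x
  obtain ⟨s, rfl⟩ := (pairsTop_bijective π).2 x
  have h1 : globalDiff H (pairsTop π s) = 0 ↔ s ∈ carlitzSections π ⊤ := by
    rw [← diffOn_eq_zero_iff H, ← toInftyTop_globalDiff_pairsTop]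
    exact (map_eq_zero_iff toInftyTop toInftyTop_injective).symm
  rw [h1]
  constructor
  · exact fun h => ⟨⟨s, h⟩, rfl⟩
  · rintro ⟨s', h⟩
    have : s'.1 = s := (pairsTop_bijective π).1 h
    exact this ▸ s'.2

lemma exact_globalDiff_connecting (hS : (sheafSequence H).ShortExact) :
    Function.Exact (globalDiff H) ((SheafCohomology.connecting hS).comp toInftyTop) := by
  intro q
  refine (SheafCohomology.connecting_exact hS (toInftyTop q)).trans ⟨?_, ?_⟩
  · rintro ⟨s, hs⟩
    exact ⟨pairsTop π s,
      toInftyTop_injective ((toInftyTop_globalDiff_pairsTop H s).trans hs)⟩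
  · rintro ⟨x, rfl⟩
    obtain ⟨s, rfl⟩ := (pairsTop_bijective π).2 x
    exact ⟨s, (toInftyTop_globalDiff_pairsTop H s).symm⟩

end CarlitzSequence

end

theorem lemma4 {k : Type u} [Field k] [Fintype k] {X : Scheme.{u}} [AlgebraicGeometry.IsIntegral X]
    (p : X ⟶ Spec (.of k)) [SmoothOfRelativeDimension 1 p] [GeometricallyConnected p]
    (hp : Carlitz.IsProjective p)
    (π : X ⟶ Carlitz.ProjSpace 1 k) (hπ : π ≫ Carlitz.ProjSpace.toSpec 1 k = p) [Surjective π] :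
    (∀ (z : Carlitz.AtInfty π) (γ : Carlitz.Completed π z.1),
      Summable (Carlitz.expTerm π z.1 γ)) ∧
    ∃ (δ : (Carlitz.C0Y π × ∀ z : Carlitz.AtInfty π, Carlitz.Completed π z.1) →ₗ[Polynomial k]
          ∀ z : Carlitz.AtInfty π, Carlitz.C0 k (Carlitz.Completed π z.1))
      (d : (∀ z : Carlitz.AtInfty π, Carlitz.C0 k (Carlitz.Completed π z.1)) →ₗ[Polynomial k]
          Carlitz.cohomology (Carlitz.carlitzSheaf (k := k) π) 1),
      (∀ c γ z, δ (c, γ) z = Carlitz.localizeY π z.1 c - Carlitz.exp π z.1 (γ z)) ∧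
      Function.Injective (Carlitz.globalInclusion (k := k) π) ∧
      Function.Exact (Carlitz.globalInclusion (k := k) π) δ ∧
      Function.Exact δ d ∧
      Function.Surjective d := by
  have := CurveGeometry.isProper_of_isProjective hp
  have := CurveGeometry.noetherianSpace p
  choose s hs using fun z : Carlitz.AtInfty π => CurveGeometry.exists_isInvCoord
    (fun _ hx hne => CurveGeometry.eq_of_specializes p hx hne) z.2
  have H : ∀ (z : Carlitz.AtInfty π) (γ : Carlitz.Completed π z.1),
      Summable (Carlitz.expTerm π z.1 γ) := fun z => (hs z).summable
  have hY : ∀ (V : X.Opens), genericPoint X ∈ V → ∀ z : X,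
      ∃ W : X.Opens, z ∈ W ∧ ∀ x ∈ W, x ∈ V ∨ x = z := fun _ hV z =>
    CurveGeometry.exists_nhd_subset p hV z
  have hS : (CarlitzSequence.sheafSequence H).ShortExact :=
    { exact := CarlitzSequence.sheafSequence_exact H
      mono_f := inferInstanceAs (Mono (CarlitzSequence.incl π))
      epi_g := CarlitzSequence.epi_diff H hY fun z => (hs z).exists_sub_exp_eq }
  refine ⟨H, CarlitzSequence.globalDiff H,
    (SheafCohomology.connecting hS).comp CarlitzSequence.toInftyTop, fun _ _ _ => rfl,
    CarlitzSequence.globalInclusion_injective π,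
    CarlitzSequence.exact_globalInclusion_globalDiff H,
    CarlitzSequence.exact_globalDiff_connecting H hS, ?_⟩
  exact (SheafCohomology.connecting_surjective hS (CarlitzSequence.pairsSheaf_cechAcyclic hY
    (CurveGeometry.isAffineOpen_finitePart hπ))).comp CarlitzSequence.toInftyTop_surjective
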